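/- Let $V:\mathbb R\to[0,\infty)$ be smooth and even with $0<\delta_-\le V''(r)\le\delta_+<\infty$ for all $r$ and $\delta_- /\delta_+>(3/4)^{1/16}$, and let $\beta,\gamma>0$. On $\Omega=(\mathbb R^2)^{\mathbb Z}$, with points $\omega=(p_i,r_i)_{i\in\mathbb Z}$, let $\nu_\beta=\prod_i \frac{e^{-\beta(p_i^2/2+V(r_i))}}{\sqrt{2\pi\beta^{-1}}\,Z_\beta}\,dp_i\,dr_i$ with $Z_\beta=\int_{\mathbb R} e^{-\beta V(r)}dr$, write $\langle\cdot\rangle_\beta$ for the expectation under $\nu_\beta$, $\mathcal E_i=p_i^2/2+V(r_i)$, and let $\tau_j$ be the shift, $\tau_jp_i=p_{i+j}$, $\tau_jr_i=r_{i+j}$. Put $$Y_{i,j}=p_i\partial_{r_j}-V'(r_j)\partial_{p_i},\qquad X_i=Y_{i,i},\qquad L=\frac{\gamma}{2}\sum_{i\in\mathbb Z}\{X_i^2+Y_{i,i+1}^2\}+\sum_{i\in\mathbb Z}\{X_i-Y_{i,i+1}\},$$ $$W_{0,1}=-p_0V'(r_1)+\frac{\gamma}{2}\{p_0^2V''(r_1)-V'(r_1)^2\}.$$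 Let $\mathcal C$ be the set of smooth local functions on $\Omega$ (functions of finitely many coordinates) with compact support (in those coordinates) and zero $\nu_\beta$-average, and for $g\in\mathcal C$ let $\Gamma_g=\sum_{j\in\mathbb Z}\tau_jg$ (a formal sum; $X_0\Gamma_g$ and $Y_{0,1}\Gamma_g$ are finite sums). For a local function $h\in L^2(\nu_\beta)$ of zero average define $$|\!|\!|h|\!|\!|_{-1}^2=\sup_{g\in\mathcal C,\,a\in\mathbb R}\Big\{2\sum_{i\in\mathbb Z}\langle g\,\tau_ih\rangle_\beta+2a\sum_{i\in\mathbb Z}i\,\langle h\,\mathcal E_i\rangle_\beta-\frac{\gamma}{2}\big\langle(a\,p_0V'(r_1)+Y_{0,1}\Gamma_g)^2\big\rangle_\beta-\frac{\gamma}{2}\big\langle(X_0\Gamma_g)^2\big\rangle_\beta\Big\}.$$ Let $\kappa_\beta$ be the diffusion constant, i.e. the real number $\kappa$ such that $W_{0,1}+\kappa\,(p_1^2-p_0^2)$ belongs to the closure of $L\mathcal C=\{LF: F\in\mathcal C\}$ with respect to $|\!|\!|\cdot|\!|\!|_{-1}$, that is, $\inf_{F\in\mathcal C}|\!|\!|W_{0,1}+\kappa\,(p_1^2-p_0^2)-LF|\!|\!|_{-1}=0$.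 Then every real number with this property, and so $\kappa_\beta$, satisfies $$\kappa_\beta\le\frac{\gamma}{4}\,\langle V''(r_0)\rangle_\beta+\frac{3}{4\gamma}.$$ -/

import Mathlib

open MeasureTheory

namespace AnharmonicChain

noncomputable section

/-- Configurations of the infinite chain: `ω i = (p_i, r_i)`. -/
abbrev Conf : Type := ℤ → ℝ × ℝ

/-- Partition function `Z_β = ∫ exp (-β V(r)) dr`. -/
def partitionZ (V : ℝ → ℝ) (β : ℝ) : ℝ := ∫ r : ℝ, Real.exp (-β * V r)

/-- One-site Gibbs measure
`exp (-β (p²/2 + V(r))) / (√(2π β⁻¹) Z_β) dp dr` on `ℝ × ℝ`. -/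
def siteMeasure (V : ℝ → ℝ) (β : ℝ) : Measure (ℝ × ℝ) :=
  (volume : Measure (ℝ × ℝ)).withDensity fun x =>
    ENNReal.ofReal
      (Real.exp (-β * (x.1 ^ 2 / 2 + V x.2)) / (√(2 * Real.pi * β⁻¹) * partitionZ V β))

/-- The Gibbs measure `ν_β` on the infinite chain. -/
def gibbs (V : ℝ → ℝ) (β : ℝ) : Measure Conf :=
  Measure.infinitePi fun _ : ℤ => siteMeasure V β

/-- Expectation `⟨f⟩_β`. -/
def avg (V : ℝ → ℝ) (β : ℝ) (f : Conf → ℝ) : ℝ := ∫ ω, f ω ∂(gibbs V β)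

/-- Shift of functions, `(τ_j f)(ω) = f ((ω_{i+j})_i)`; thus `τ_j p_i = p_{i+j}`. -/
def shift (j : ℤ) (f : Conf → ℝ) : Conf → ℝ := fun ω => f fun i => ω (i + j)

/-- `∂f/∂p_i`. -/
def dP (i : ℤ) (f : Conf → ℝ) : Conf → ℝ := fun ω =>
  deriv (fun x : ℝ => f (Function.update ω i (x, (ω i).2))) (ω i).1

/-- `∂f/∂r_i`. -/
def dR (i : ℤ) (f : Conf → ℝ) : Conf → ℝ := fun ω =>
  deriv (fun x : ℝ => f (Function.update ω i ((ω i).1, x))) (ω i).2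

/-- `Y_{i,j} = p_i ∂_{r_j} - V'(r_j) ∂_{p_i}`. -/
def opY (V : ℝ → ℝ) (i j : ℤ) (f : Conf → ℝ) : Conf → ℝ := fun ω =>
  (ω i).1 * dR j f ω - deriv V (ω j).2 * dP i f ω

/-- `X_i = Y_{i,i}`. -/
def opX (V : ℝ → ℝ) (i : ℤ) (f : Conf → ℝ) : Conf → ℝ := opY V i i f

/-- `A f = ∑_i (X_i f - Y_{i,i+1} f)`; for a local function the sum is finite. -/
def opA (V : ℝ → ℝ) (f : Conf → ℝ) : Conf → ℝ := fun ω =>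
  ∑ᶠ i : ℤ, (opX V i f ω - opY V i (i + 1) f ω)

/-- `S f = (γ/2) ∑_i (X_i² f + Y_{i,i+1}² f)`; for a local function the sum is finite. -/
def opS (V : ℝ → ℝ) (γ : ℝ) (f : Conf → ℝ) : Conf → ℝ := fun ω =>
  γ / 2 * ∑ᶠ i : ℤ,
    (opX V i (opX V i f) ω + opY V i (i + 1) (opY V i (i + 1) f) ω)

/-- The generator `L = S + A`. -/
def opL (V : ℝ → ℝ) (γ : ℝ) (f : Conf → ℝ) : Conf → ℝ := fun ω => opS V γ f ω + opA V f ω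

/-- The class `𝒞` of smooth local functions with compact support (as functions of the finitely
many coordinates they depend on) and zero average with respect to `ν_β`. -/
def testFunctions (V : ℝ → ℝ) (β : ℝ) : Set (Conf → ℝ) :=
  {f | (∃ (Λ : Finset ℤ) (φ : (Λ → ℝ × ℝ) → ℝ),
      ContDiff ℝ ((⊤ : ℕ∞) : WithTop ℕ∞) φ ∧ HasCompactSupport φ ∧ ∀ ω : Conf, f ω = φ fun i => ω i) ∧
    avg V β f = 0}

/-- `X_0 Γ_g`, where `Γ_g = ∑_j τ_j g` is a formal sum: for a local `g` only finitely many
of the terms `X_0 (τ_j g)` are non-zero. -/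
def XGamma (V : ℝ → ℝ) (g : Conf → ℝ) : Conf → ℝ := fun ω =>
  ∑ᶠ j : ℤ, opX V 0 (shift j g) ω

/-- `Y_{0,1} Γ_g`. -/
def YGamma (V : ℝ → ℝ) (g : Conf → ℝ) : Conf → ℝ := fun ω =>
  ∑ᶠ j : ℤ, opY V 0 1 (shift j g) ω

/-- Energy of the `i`-th oscillator, `ℰ_i = p_i²/2 + V(r_i)`. -/
def energy (V : ℝ → ℝ) (i : ℤ) : Conf → ℝ := fun ω => (ω i).1 ^ 2 / 2 + V (ω i).2

/-- `≪g, h≫_* = ∑_i ⟨g τ_i h⟩`; for local functions of zero average the sum is finite. -/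
def starForm (V : ℝ → ℝ) (β : ℝ) (g h : Conf → ℝ) : ℝ :=
  ∑ᶠ i : ℤ, avg V β fun ω => g ω * shift i h ω

/-- `≪h≫_** = ∑_i i ⟨h ℰ_i⟩`; for a local function of zero average the sum is finite. -/
def starStarForm (V : ℝ → ℝ) (β : ℝ) (h : Conf → ℝ) : ℝ :=
  ∑ᶠ i : ℤ, (i : ℝ) * avg V β fun ω => h ω * energy V i ω

/-- The squared semi-norm
`⦀h⦀²_{-1} = sup_{g ∈ 𝒞, a ∈ ℝ} { 2 ≪g,h≫_* + 2 a ≪h≫_**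
    - (γ/2) ⟨(a p_0 V'(r_1) + Y_{0,1} Γ_g)²⟩ - (γ/2) ⟨(X_0 Γ_g)²⟩ }`,
as an extended real number. -/
def seminormSq (V : ℝ → ℝ) (β γ : ℝ) (h : Conf → ℝ) : EReal :=
  ⨆ g ∈ testFunctions V β, ⨆ a : ℝ,
    ((2 * starForm V β g h + 2 * a * starStarForm V β h
      - γ / 2 * avg V β (fun ω => (a * ((ω 0).1 * deriv V (ω 1).2) + YGamma V g ω) ^ 2)
      - γ / 2 * avg V β (fun ω => XGamma V g ω ^ 2) : ℝ) : EReal)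

/-- The microscopic energy current
`W_{0,1} = -p_0 V'(r_1) + (γ/2) (p_0² V''(r_1) - V'(r_1)²)`. -/
def current (V : ℝ → ℝ) (γ : ℝ) : Conf → ℝ := fun ω =>
  -(ω 0).1 * deriv V (ω 1).2
    + γ / 2 * ((ω 0).1 ^ 2 * deriv (deriv V) (ω 1).2 - deriv V (ω 1).2 ^ 2)

/-- `κ` is the diffusion constant `κ_β`: the number `κ` such that `W_{0,1} + κ (p_1² - p_0²)`
lies in the closure of `L𝒞` for the semi-norm `⦀·⦀_{-1}`. -/
def IsDiffusionConstant (V : ℝ → ℝ) (β γ κ : ℝ) : Prop :=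
  ∀ ε : ℝ, 0 < ε → ∃ F ∈ testFunctions V β,
    seminormSq V β γ
      (fun ω => current V γ ω + κ * ((ω 1).1 ^ 2 - (ω 0).1 ^ 2) - opL V γ F ω) < (ε : EReal)

end

end AnharmonicChain

/-!
Each field `Y_{i,j}` is antisymmetric in `L²(ν_β)` (Gaussian-type integration by parts), and the
current is a derivative, `W_{0,1} = Y_{0,1} ψ_1` with
`ψ_1 = (p_0² - β⁻¹) / 2 + (γ/2) p_0 V'(r_1)`. Hence the pairings in the semi-norm of
`W_{0,1} + κ (p_1² - p_0²) - L F` become inner products with the gradients `X_0 Γ_g` and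
`Y_{0,1} Γ_g`. We test the semi-norm with `g = t (F + (p_0² - β⁻¹) / 2)` and `a = t`, for which the
tilt `a p_0 V'(r_1)` is cancelled by `Y_{0,1}` of the kinetic energy. This `g` has no compact
support, but cutoffs of it converge with all moments. Completing the square in the terms linear in
`t` gives

`2 t (κ β⁻² - (2γ)⁻¹ ⟨ψ_0² + ψ_1²⟩ + D) - t² (2 D + C) ≤ ⦀W_{0,1} + κ (p_1² - p_0²) - L F⦀²_{-1}`

with `D ≥ 0` depending on `F` and `C` not depending on it. Since the right side can be made smaller
than `t²`, letting `t → 0` yields `κ ≤ (β² / (2γ)) ⟨ψ_0² + ψ_1²⟩ = (γ/4) ⟨V''(r_0)⟩ + 1/(2γ)`.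
-/

namespace AnharmonicChain

noncomputable section

open Filter Topology

/-! ### Functions with all moments -/

section Moments

variable {α α' : Type*} {mα : MeasurableSpace α} {mα' : MeasurableSpace α'}
  {μ : Measure α} {μ' : Measure α'} {f g : α → ℝ}

/-- `f` has all moments under `μ`: it belongs to `L^k(μ)` for every finite `k`. On a probability
space these functions form an algebra, so that no exponents have to be tracked. -/
def HasAllMoments (f : α → ℝ) (μ : Measure α) : Prop := ∀ k : ℕ, MemLp f k μ

namespace HasAllMoments

lemma integrable (hf : HasAllMoments f μ) : Integrable f μ :=
  memLp_one_iff_integrable.1 (by simpa using hf 1)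

lemma aestronglyMeasurable (hf : HasAllMoments f μ) : AEStronglyMeasurable f μ :=
  (hf 1).aestronglyMeasurable

lemma const [IsFiniteMeasure μ] (c : ℝ) : HasAllMoments (fun _ => c) μ := fun _ => memLp_const c

lemma add (hf : HasAllMoments f μ) (hg : HasAllMoments g μ) :
    HasAllMoments (fun x => f x + g x) μ :=
  fun k => (hf k).add (hg k)

lemma sub (hf : HasAllMoments f μ) (hg : HasAllMoments g μ) :
    HasAllMoments (fun x => f x - g x) μ :=
  fun k => (hf k).sub (hg k)

lemma const_mul (hf : HasAllMoments f μ) (c : ℝ) : HasAllMoments (fun x => c * f x) μ :=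
  fun k => (hf k).const_mul c

lemma abs (hf : HasAllMoments f μ) : HasAllMoments (fun x => |f x|) μ := fun k => (hf k).abs

lemma mul (hf : HasAllMoments f μ) (hg : HasAllMoments g μ) :
    HasAllMoments (fun x => f x * g x) μ := by
  intro k
  have : ENNReal.HolderTriple ((2 * k : ℕ) : ENNReal) ((2 * k : ℕ) : ENNReal) (k : ENNReal) := by
    constructor
    push_cast
    rw [ENNReal.mul_inv (by simp) (by simp), ← add_mul, ENNReal.inv_two_add_inv_two, one_mul]
  exact (hg (2 * k)).mul (hf (2 * k))

lemma sq (hf : HasAllMoments f μ) : HasAllMoments (fun x => f x ^ 2) μ := by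
  simpa only [_root_.sq] using hf.mul hf

lemma mono (hg : HasAllMoments g μ) (hf : AEStronglyMeasurable f μ) (hfg : ∀ x, |f x| ≤ g x) :
    HasAllMoments f μ :=
  fun k => (hg k).mono' hf (.of_forall hfg)

lemma comp_measurePreserving {T : α' → α} (hf : HasAllMoments f μ)
    (hT : MeasurePreserving T μ' μ) : HasAllMoments (fun x => f (T x)) μ' :=
  fun k => (hf k).comp_measurePreserving hT

end HasAllMoments

lemma hasAllMoments_of_integrable_abs_pow (hf : AEStronglyMeasurable f μ)
    (hint : ∀ k : ℕ, Integrable (fun x => |f x| ^ k) μ) : HasAllMoments f μ := by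
  intro k
  rcases eq_or_ne k 0 with rfl | hk
  · simpa using hf
  · refine (integrable_norm_rpow_iff hf (by simpa using hk) (by simp)).1 ?_
    simpa using hint k

end Moments

section Resampling

variable {ι : Type*} [DecidableEq ι] {X : ι → Type*}

lemma preimage_update_pi (i : ι) (s : Finset ι) (t : ∀ k, Set (X k)) :
    (fun z : (∀ k, X k) × X i => Function.update z.1 i z.2) ⁻¹' (s : Set ι).pi t
      = ((s.erase i : Finset ι) : Set ι).pi t ×ˢ (if i ∈ s then t i else Set.univ) := by
  ext z
  simp only [Set.mem_preimage, Set.mem_pi, Set.mem_prod, Finset.mem_coe, Finset.mem_erase]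
  constructor
  · intro hz
    refine ⟨fun k hk => by simpa [Function.update_of_ne hk.1] using hz k hk.2, ?_⟩
    split_ifs with hi
    · simpa using hz i hi
    · trivial
  · rintro ⟨h_off, h_on⟩ k hk
    by_cases hki : k = i
    · subst hki
      simpa [hk] using h_on
    · simpa [Function.update_of_ne hki] using h_off k ⟨hki, hk⟩

variable [∀ i, MeasurableSpace (X i)]

lemma measurable_uncurry_update (i : ι) :
    Measurable fun z : (∀ k, X k) × X i => Function.update z.1 i z.2 := by
  refine measurable_pi_iff.2 fun k => ?_
  by_cases hk : k = i
  · subst hk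
    simpa using measurable_snd
  · simp only [Function.update_of_ne hk]
    fun_prop

lemma measurePreserving_update_infinitePi (μ : ∀ i, Measure (X i))
    [∀ i, IsProbabilityMeasure (μ i)] (i : ι) :
    MeasurePreserving (fun z : (∀ k, X k) × X i => Function.update z.1 i z.2)
      ((Measure.infinitePi μ).prod (μ i)) (Measure.infinitePi μ) := by
  refine ⟨measurable_uncurry_update i, Measure.eq_infinitePi _ fun s t ht => ?_⟩
  rw [Measure.map_apply (measurable_uncurry_update i) (.pi s.countable_toSet fun _ _ => ht _),
    preimage_update_pi, Measure.prod_prod, Measure.infinitePi_pi _ fun i _ => ht i]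
  split_ifs with hi
  · rw [Finset.prod_erase_mul _ _ hi]
  · rw [measure_univ, mul_one, Finset.erase_eq_of_notMem hi]

end Resampling

/-! ### The potential -/

section Potential

lemma abs_le_add_mul_abs_of_abs_deriv_le {f : ℝ → ℝ} (hf : Differentiable ℝ f) {C r : ℝ}
    (hC : ∀ x, |x| ≤ |r| → |deriv f x| ≤ C) : |f r| ≤ |f 0| + C * |r| := by
  have mean_value : |f r - f 0| ≤ C * |r| := by
    simpa using Convex.norm_image_sub_le_of_norm_deriv_le (s := Set.Icc (-|r|) |r|) (x := 0)
      (fun x _ => hf x) (fun x hx => hC x (abs_le.2 hx)) (convex_Icc _ _) (by simp)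
      (abs_le.1 le_rfl)
  linarith [abs_sub_abs_le_abs_sub (f r) (f 0)]

lemma convexOn_sub_mul_sq {f : ℝ → ℝ} (hf : ContDiff ℝ 2 f) {m : ℝ}
    (hm : ∀ x, m ≤ deriv (deriv f) x) : ConvexOn ℝ Set.univ fun x => f x - m / 2 * x ^ 2 := by
  have hf' : Differentiable ℝ f := hf.differentiable two_ne_zero
  have hf'' : Differentiable ℝ (deriv f) := hf.differentiable_deriv_two
  have deriv_eq : deriv (fun x => f x - m / 2 * x ^ 2) = fun x => deriv f x - m * x := by
    funext x
    refine HasDerivAt.deriv (((hf' x).hasDerivAt.sub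
      ((hasDerivAt_pow 2 x).const_mul (m / 2))).congr_deriv ?_)
    push_cast
    ring
  have deriv_deriv_eq : deriv (fun x => deriv f x - m * x) = fun x => deriv (deriv f) x - m := by
    funext x
    exact HasDerivAt.deriv (((hf'' x).hasDerivAt.sub ((hasDerivAt_id x).const_mul m)).congr_deriv
      (by ring))
  refine convexOn_univ_of_deriv2_nonneg (hf'.sub (by fun_prop)) ?_ fun x => ?_
  · rw [deriv_eq]
    exact hf''.sub (by fun_prop)
  · rw [Function.iterate_succ, Function.iterate_one, Function.comp_apply, deriv_eq, deriv_deriv_eq]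
    exact sub_nonneg.2 (hm x)

lemma exists_mul_sq_sub_le {f : ℝ → ℝ} (hf : ContDiff ℝ 2 f) {m : ℝ} (hm_pos : 0 < m)
    (hm : ∀ x, m ≤ deriv (deriv f) x) : ∃ c, ∀ x, m / 4 * x ^ 2 - c ≤ f x := by
  obtain ⟨a, b, hab⟩ := (convexOn_sub_mul_sq hf hm).exists_affine_le_real isClosed_univ
    ((hf.continuous.sub (by fun_prop)).lowerSemicontinuous.lowerSemicontinuousOn _)
  refine ⟨a ^ 2 / m - b, fun x => ?_⟩
  have complete_square : 0 ≤ m / 4 * x ^ 2 + a * x + a ^ 2 / m := by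
    have : m / 4 * x ^ 2 + a * x + a ^ 2 / m = m * (x / 2 + a / m) ^ 2 := by
      field_simp
      ring
    rw [this]
    positivity
  have above_line : a * x + b ≤ f x - m / 2 * x ^ 2 := hab x trivial
  linarith

/-- The assumption on the interaction potential: it is twice continuously differentiable, and its
second derivative is bounded above and bounded below by a positive constant. -/
class IsConvexPotential (V : ℝ → ℝ) : Prop where
  contDiff : ContDiff ℝ 2 V
  exists_bounds : ∃ m M : ℝ, 0 < m ∧ ∀ r, m ≤ deriv (deriv V) r ∧ deriv (deriv V) r ≤ M

namespace IsConvexPotential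

variable {V : ℝ → ℝ}

lemma differentiable (hV : IsConvexPotential V) : Differentiable ℝ V :=
  hV.contDiff.differentiable two_ne_zero

lemma continuous (hV : IsConvexPotential V) : Continuous V := hV.contDiff.continuous

lemma differentiable_deriv (hV : IsConvexPotential V) : Differentiable ℝ (deriv V) :=
  hV.contDiff.differentiable_deriv_two

lemma continuous_deriv (hV : IsConvexPotential V) : Continuous (deriv V) :=
  hV.differentiable_deriv.continuous

lemma continuous_deriv_deriv (hV : IsConvexPotential V) : Continuous (deriv (deriv V)) :=
  ((contDiff_succ_iff_deriv (n := 1)).1 hV.contDiff).2.2.continuous_deriv_one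

lemma exists_abs_deriv_deriv_le (hV : IsConvexPotential V) :
    ∃ M, ∀ r, |deriv (deriv V) r| ≤ M := by
  obtain ⟨m, M, hm, hM⟩ := hV.exists_bounds
  exact ⟨M, fun r => by rw [abs_of_pos (hm.trans_le (hM r).1)]; exact (hM r).2⟩

lemma exists_abs_deriv_le (hV : IsConvexPotential V) : ∃ A M, ∀ r, |deriv V r| ≤ A + M * |r| := by
  obtain ⟨M, hM⟩ := hV.exists_abs_deriv_deriv_le
  exact ⟨|deriv V 0|, M, fun r =>
    abs_le_add_mul_abs_of_abs_deriv_le hV.differentiable_deriv fun x _ => hM x⟩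

lemma exists_abs_le (hV : IsConvexPotential V) :
    ∃ A B M, ∀ r, |V r| ≤ A + (B + M * |r|) * |r| := by
  obtain ⟨M, hM⟩ := hV.exists_abs_deriv_deriv_le
  have hM_nonneg : 0 ≤ M := (abs_nonneg _).trans (hM 0)
  refine ⟨|V 0|, |deriv V 0|, M, fun r =>
    abs_le_add_mul_abs_of_abs_deriv_le hV.differentiable fun x hx => ?_⟩
  calc |deriv V x| ≤ |deriv V 0| + M * |x| :=
        abs_le_add_mul_abs_of_abs_deriv_le hV.differentiable_deriv fun y _ => hM y
    _ ≤ |deriv V 0| + M * |r| := by gcongr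

lemma exists_mul_sq_sub_le (hV : IsConvexPotential V) :
    ∃ a c : ℝ, 0 < a ∧ ∀ r, a * r ^ 2 - c ≤ V r := by
  obtain ⟨m, M, hm, hM⟩ := hV.exists_bounds
  obtain ⟨c, hc⟩ := AnharmonicChain.exists_mul_sq_sub_le hV.contDiff hm fun r => (hM r).1
  exact ⟨m / 4, c, by positivity, hc⟩

end IsConvexPotential

end Potential

/-! ### The one-site measure -/

section Site

lemma integrable_abs_pow_mul_exp_neg_mul_sq {b : ℝ} (hb : 0 < b) (k : ℕ) :
    Integrable fun x : ℝ => |x| ^ k * Real.exp (-b * x ^ 2) := by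
  have hk : (-1 : ℝ) < k := neg_one_lt_zero.trans_le k.cast_nonneg
  simpa [Real.rpow_natCast] using (integrable_rpow_mul_exp_neg_mul_sq hb hk).norm

/-- The density of `siteMeasure V β` with respect to Lebesgue measure. -/
def siteDensity (V : ℝ → ℝ) (β : ℝ) (x : ℝ × ℝ) : ℝ :=
  Real.exp (-β * (x.1 ^ 2 / 2 + V x.2)) / (√(2 * Real.pi * β⁻¹) * partitionZ V β)

lemma siteDensity_eq_mul (V : ℝ → ℝ) (β : ℝ) (x : ℝ × ℝ) :
    siteDensity V β x = Real.exp (-(β / 2) * x.1 ^ 2) / √(2 * Real.pi * β⁻¹) *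
      (Real.exp (-β * V x.2) / partitionZ V β) := by
  rw [siteDensity, div_mul_div_comm, ← Real.exp_add]
  congr 2
  ring

lemma siteMeasure_eq_withDensity (V : ℝ → ℝ) (β : ℝ) :
    siteMeasure V β = volume.withDensity fun x => ENNReal.ofReal (siteDensity V β x) := rfl

lemma siteDensity_nonneg (V : ℝ → ℝ) (β : ℝ) (x : ℝ × ℝ) : 0 ≤ siteDensity V β x :=
  div_nonneg (Real.exp_nonneg _)
    (mul_nonneg (Real.sqrt_nonneg _) (integral_nonneg fun _ => Real.exp_nonneg _))

variable {V : ℝ → ℝ} [hV : IsConvexPotential V] {β : ℝ}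

lemma measurable_siteDensity : Measurable (siteDensity V β) := by
  have := hV.contDiff.continuous
  unfold siteDensity
  exact (by fun_prop : Continuous _).measurable

lemma integrable_siteMeasure_iff {f : ℝ × ℝ → ℝ} :
    Integrable f (siteMeasure V β) ↔ Integrable fun x => siteDensity V β x * f x := by
  rw [siteMeasure_eq_withDensity, integrable_withDensity_iff_integrable_smul'
    measurable_siteDensity.ennreal_ofReal (by simp)]
  simp [ENNReal.toReal_ofReal (siteDensity_nonneg V β _)]

lemma integral_siteMeasure (f : ℝ × ℝ → ℝ) :
    ∫ x, f x ∂siteMeasure V β = ∫ x, siteDensity V β x * f x := by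
  rw [siteMeasure_eq_withDensity, integral_withDensity_eq_integral_toReal_smul
    measurable_siteDensity.ennreal_ofReal (by simp)]
  simp [ENNReal.toReal_ofReal (siteDensity_nonneg V β _)]

lemma hasLineDerivAt_siteDensity (x v : ℝ × ℝ) :
    HasLineDerivAt ℝ (siteDensity V β)
      (-β * (v.1 * x.1 + v.2 * deriv V x.2) * siteDensity V β x) x v := by
  have line_fst : HasDerivAt (fun t : ℝ => x.1 + t * v.1) v.1 0 := by
    simpa using ((hasDerivAt_id (0 : ℝ)).mul_const v.1).const_add x.1
  have line_snd : HasDerivAt (fun t : ℝ => x.2 + t * v.2) v.2 0 := by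
    simpa using ((hasDerivAt_id (0 : ℝ)).mul_const v.2).const_add x.2
  have deriv_V : HasDerivAt V (deriv V x.2) (x.2 + 0 * v.2) := by
    simpa using (hV.differentiable x.2).hasDerivAt
  refine HasDerivAt.congr_deriv (((((line_fst.pow 2).div_const 2).add
    (deriv_V.comp (0 : ℝ) line_snd)).const_mul (-β)).exp.div_const
      (√(2 * Real.pi * β⁻¹) * partitionZ V β)) ?_
  simp only [siteDensity, Pi.pow_apply, Pi.add_apply, Function.comp_apply, zero_mul, add_zero,
    Nat.cast_ofNat, Nat.add_one_sub_one, pow_one]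
  ring

lemma integral_siteMeasure_lineDeriv {v : ℝ × ℝ} {φ φ' : ℝ × ℝ → ℝ}
    (hφ : ∀ x, HasLineDerivAt ℝ φ (φ' x) x v)
    (hφ_int : Integrable φ (siteMeasure V β)) (hφ'_int : Integrable φ' (siteMeasure V β))
    (hvφ_int : Integrable (fun x => (v.1 * x.1 + v.2 * deriv V x.2) * φ x) (siteMeasure V β)) :
    ∫ x, φ' x ∂siteMeasure V β
      = β * ∫ x, (v.1 * x.1 + v.2 * deriv V x.2) * φ x ∂siteMeasure V β := by
  rw [integrable_siteMeasure_iff] at hφ_int hφ'_int hvφ_int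
  have by_parts := integral_bilinear_hasLineDerivAt_right_eq_neg_left_of_integrable
    (μ := (volume : Measure (ℝ × ℝ))) (B := ContinuousLinearMap.mul ℝ ℝ)
    (f' := fun x => -β * (v.1 * x.1 + v.2 * deriv V x.2) * siteDensity V β x)
    (by refine (hvφ_int.const_mul (-β)).congr (.of_forall fun x => ?_)
        simp only [ContinuousLinearMap.mul_apply']
        ring)
    (by simpa using hφ'_int) (by simpa using hφ_int)
    (fun x _ => hasLineDerivAt_siteDensity x v) (fun x _ => hφ x)
  simp only [ContinuousLinearMap.mul_apply'] at by_parts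
  rw [integral_siteMeasure, integral_siteMeasure, by_parts, ← integral_neg, ← integral_const_mul]
  congr 1
  funext x
  ring

variable [hβ : Fact (0 < β)]

lemma integrable_abs_pow_mul_exp_neg_mul_potential (k : ℕ) :
    Integrable fun r : ℝ => |r| ^ k * Real.exp (-β * V r) := by
  obtain ⟨a, c, ha, hac⟩ := hV.exists_mul_sq_sub_le
  have := hV.continuous
  refine ((integrable_abs_pow_mul_exp_neg_mul_sq (mul_pos hβ.out ha) k).const_mul
    (Real.exp (β * c))).mono' (by fun_prop : Continuous _).aestronglyMeasurable
    (.of_forall fun r => ?_)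
  have exponent_le : -β * V r ≤ β * c + -(β * a) * r ^ 2 := by
    linarith [mul_le_mul_of_nonneg_left (hac r) hβ.out.le]
  calc ‖|r| ^ k * Real.exp (-β * V r)‖ = |r| ^ k * Real.exp (-β * V r) :=
        Real.norm_of_nonneg (by positivity)
    _ ≤ |r| ^ k * Real.exp (β * c + -(β * a) * r ^ 2) := by gcongr
    _ = Real.exp (β * c) * (|r| ^ k * Real.exp (-(β * a) * r ^ 2)) := by
        rw [Real.exp_add]
        ring

lemma partitionZ_pos : 0 < partitionZ V β :=
  integral_exp_pos (by simpa using integrable_abs_pow_mul_exp_neg_mul_potential (V := V) (β := β) 0)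

lemma integrable_abs_pow_mul_abs_pow (k l : ℕ) :
    Integrable (fun x : ℝ × ℝ => |x.1| ^ k * |x.2| ^ l) (siteMeasure V β) := by
  rw [integrable_siteMeasure_iff]
  have int_p := (integrable_abs_pow_mul_exp_neg_mul_sq (half_pos hβ.out) k).div_const
    √(2 * Real.pi * β⁻¹)
  have int_r := (integrable_abs_pow_mul_exp_neg_mul_potential (V := V) (β := β) l).div_const
    (partitionZ V β)
  refine (int_p.mul_prod int_r).congr (.of_forall fun x => ?_)
  simp only [siteDensity_eq_mul]
  ring

lemma integral_siteDensity : ∫ x, siteDensity V β x = 1 := by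
  have hβ_pos := hβ.out
  have gaussian : ∫ p : ℝ, Real.exp (-(β / 2) * p ^ 2) = √(2 * Real.pi * β⁻¹) := by
    rw [integral_gaussian, show Real.pi / (β / 2) = 2 * Real.pi * β⁻¹ by field_simp]
  simp only [siteDensity_eq_mul]
  rw [Measure.volume_eq_prod, integral_prod_mul
    (fun p : ℝ => Real.exp (-(β / 2) * p ^ 2) / √(2 * Real.pi * β⁻¹))
    (fun r : ℝ => Real.exp (-β * V r) / partitionZ V β), integral_div, integral_div, gaussian,
    ← partitionZ, div_self partitionZ_pos.ne', mul_one,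
    div_self (Real.sqrt_pos.2 (by positivity)).ne']

instance : IsProbabilityMeasure (siteMeasure V β) := by
  have density_int : Integrable (siteDensity V β) := by
    simpa using integrable_siteMeasure_iff.1 (integrable_abs_pow_mul_abs_pow (V := V) (β := β) 0 0)
  constructor
  rw [siteMeasure_eq_withDensity, withDensity_apply _ MeasurableSet.univ, Measure.restrict_univ,
    ← ofReal_integral_eq_lintegral_ofReal density_int (.of_forall (siteDensity_nonneg V β)),
    integral_siteDensity, ENNReal.ofReal_one]

lemma hasAllMoments_p : HasAllMoments Prod.fst (siteMeasure V β) :=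
  hasAllMoments_of_integrable_abs_pow measurable_fst.aestronglyMeasurable fun k => by
    simpa using integrable_abs_pow_mul_abs_pow (V := V) (β := β) k 0

lemma hasAllMoments_r : HasAllMoments Prod.snd (siteMeasure V β) :=
  hasAllMoments_of_integrable_abs_pow measurable_snd.aestronglyMeasurable fun k => by
    simpa using integrable_abs_pow_mul_abs_pow (V := V) (β := β) 0 k

lemma hasAllMoments_potential : HasAllMoments (fun x => V x.2) (siteMeasure V β) := by
  obtain ⟨A, B, M, hV_le⟩ := hV.exists_abs_le
  have abs_r := (hasAllMoments_r (V := V) (β := β)).abs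
  exact ((HasAllMoments.const A).add (((HasAllMoments.const B).add (abs_r.const_mul M)).mul
    abs_r)).mono (hV.continuous.comp continuous_snd).aestronglyMeasurable fun x => hV_le x.2

lemma hasAllMoments_force : HasAllMoments (fun x => deriv V x.2) (siteMeasure V β) := by
  obtain ⟨A, M, hV'_le⟩ := hV.exists_abs_deriv_le
  exact ((HasAllMoments.const A).add (hasAllMoments_r.abs.const_mul M)).mono
    (hV.continuous_deriv.comp continuous_snd).aestronglyMeasurable fun x => hV'_le x.2

lemma hasAllMoments_deriv_force :
    HasAllMoments (fun x => deriv (deriv V) x.2) (siteMeasure V β) := by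
  obtain ⟨M, hV''_le⟩ := hV.exists_abs_deriv_deriv_le
  exact (HasAllMoments.const M).mono
    (hV.continuous_deriv_deriv.comp continuous_snd).aestronglyMeasurable fun x => hV''_le x.2

end Site

/-! ### The Gibbs measure -/

section Gibbs

variable {V : ℝ → ℝ} {β : ℝ} {f g : Conf → ℝ}

lemma avg_add (hf : HasAllMoments f (gibbs V β)) (hg : HasAllMoments g (gibbs V β)) :
    avg V β (fun ω => f ω + g ω) = avg V β f + avg V β g :=
  integral_add hf.integrable hg.integrable

lemma avg_sub (hf : HasAllMoments f (gibbs V β)) (hg : HasAllMoments g (gibbs V β)) :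
    avg V β (fun ω => f ω - g ω) = avg V β f - avg V β g :=
  integral_sub hf.integrable hg.integrable

lemma avg_const_mul (c : ℝ) (f : Conf → ℝ) : avg V β (fun ω => c * f ω) = c * avg V β f :=
  integral_const_mul c f

lemma avg_neg (f : Conf → ℝ) : avg V β (fun ω => -f ω) = -avg V β f := integral_neg f

lemma avg_sum {ι : Type*} (s : Finset ι) {F : ι → Conf → ℝ}
    (hF : ∀ i ∈ s, HasAllMoments (F i) (gibbs V β)) :
    avg V β (fun ω => ∑ i ∈ s, F i ω) = ∑ i ∈ s, avg V β (F i) :=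
  integral_finsetSum s fun i hi => (hF i hi).integrable

lemma shift_zero (f : Conf → ℝ) : shift 0 f = f := by
  funext ω
  simp [shift]

lemma shift_shift (i j : ℤ) (f : Conf → ℝ) : shift i (shift j f) = shift (i + j) f := by
  funext ω
  simp only [shift]
  congr 1
  funext k
  congr 1
  ring

variable [IsConvexPotential V] [Fact (0 < β)]

instance : IsProbabilityMeasure (gibbs V β) := by
  unfold gibbs
  infer_instance

lemma avg_const (c : ℝ) : avg V β (fun _ => c) = c := by
  simp [avg]

lemma measurePreserving_shift (j : ℤ) :
    MeasurePreserving (fun (ω : Conf) i => ω (i + j)) (gibbs V β) (gibbs V β) :=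
  ⟨by fun_prop, Measure.map_infinitePi_infinitePi_of_inj (P := fun _ : ℤ => siteMeasure V β)
    (add_left_injective j)⟩

lemma measurePreserving_eval (i : ℤ) :
    MeasurePreserving (fun ω : Conf => ω i) (gibbs V β) (siteMeasure V β) :=
  measurePreserving_eval_infinitePi (fun _ : ℤ => siteMeasure V β) i

lemma hasAllMoments_shift (hf : HasAllMoments f (gibbs V β)) (j : ℤ) :
    HasAllMoments (shift j f) (gibbs V β) :=
  hf.comp_measurePreserving (measurePreserving_shift j)

lemma avg_shift (j : ℤ) (f : Conf → ℝ) : avg V β (shift j f) = avg V β f := by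
  have embedding : MeasurableEmbedding (fun (ω : Conf) i => ω (i + j)) := by
    convert (MeasurableEquiv.piCongrLeft (fun _ : ℤ => ℝ × ℝ)
      (Equiv.subRight j)).measurableEmbedding using 1
    ext ω i
    all_goals simp [MeasurableEquiv.coe_piCongrLeft, Equiv.piCongrLeft_apply]
  exact (measurePreserving_shift j).integral_comp embedding f

lemma integrable_comp_update (hf : Integrable f (gibbs V β)) (i : ℤ) :
    Integrable (fun z : Conf × (ℝ × ℝ) => f (Function.update z.1 i z.2))
      ((gibbs V β).prod (siteMeasure V β)) :=
  (measurePreserving_update_infinitePi (fun _ : ℤ => siteMeasure V β) i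
    ).integrable_comp_of_integrable hf

lemma avg_eq_integral_integral_update (hf : Integrable f (gibbs V β)) (i : ℤ) :
    avg V β f = ∫ ω, ∫ x, f (Function.update ω i x) ∂siteMeasure V β ∂gibbs V β := by
  have resample : MeasurePreserving (fun z : Conf × (ℝ × ℝ) => Function.update z.1 i z.2)
      ((gibbs V β).prod (siteMeasure V β)) (gibbs V β) :=
    measurePreserving_update_infinitePi (fun _ : ℤ => siteMeasure V β) i
  rw [avg, ← resample.map_eq, integral_map resample.measurable.aemeasurable
    (by rw [resample.map_eq]; exact hf.aestronglyMeasurable), resample.map_eq]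
  exact integral_prod _ (integrable_comp_update hf i)

lemma avg_lineDeriv (i : ℤ) {v : ℝ × ℝ} {f' : Conf → ℝ}
    (hf : ∀ ω x, HasLineDerivAt ℝ (fun x => f (Function.update ω i x))
      (f' (Function.update ω i x)) x v)
    (hf_int : Integrable f (gibbs V β)) (hf'_int : Integrable f' (gibbs V β))
    (hvf_int : Integrable (fun ω => (v.1 * (ω i).1 + v.2 * deriv V (ω i).2) * f ω) (gibbs V β)) :
    avg V β f' = β * avg V β fun ω => (v.1 * (ω i).1 + v.2 * deriv V (ω i).2) * f ω := by
  rw [avg_eq_integral_integral_update hf'_int i, avg_eq_integral_integral_update hvf_int i,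
    ← integral_const_mul]
  refine integral_congr_ae ?_
  filter_upwards [(integrable_comp_update hf_int i).prod_right_ae,
    (integrable_comp_update hf'_int i).prod_right_ae,
    (integrable_comp_update hvf_int i).prod_right_ae] with ω f_int f'_int vf_int
  simp only [Function.update_self] at vf_int ⊢
  exact integral_siteMeasure_lineDeriv (hf ω) f_int f'_int vf_int

end Gibbs

/-! ### Derivatives in the coordinates of a site -/

section SiteDeriv

variable {V : ℝ → ℝ} {β : ℝ} {f g : Conf → ℝ}

/-- The derivative of `f` in the coordinates `(p_i, r_i)` of the site `i`, in the direction `v`. It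
treats `∂_{p_i}`, for `v = (1, 0)`, and `∂_{r_i}`, for `v = (0, 1)`, together. -/
def siteDeriv (v : ℝ × ℝ) (i : ℤ) (f : Conf → ℝ) : Conf → ℝ := fun ω =>
  lineDeriv ℝ (fun x => f (Function.update ω i x)) (ω i) v

lemma dP_eq_siteDeriv (i : ℤ) (f : Conf → ℝ) : dP i f = siteDeriv (1, 0) i f := by
  funext ω
  have translate := deriv_comp_const_add
    (fun x : ℝ => f (Function.update ω i (x, (ω i).2))) (ω i).1 0
  rw [add_zero] at translate
  simp [dP, siteDeriv, lineDeriv, ← translate, Prod.add_def]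

lemma dR_eq_siteDeriv (i : ℤ) (f : Conf → ℝ) : dR i f = siteDeriv (0, 1) i f := by
  funext ω
  have translate := deriv_comp_const_add
    (fun x : ℝ => f (Function.update ω i ((ω i).1, x))) (ω i).2 0
  rw [add_zero] at translate
  simp [dR, siteDeriv, lineDeriv, ← translate, Prod.add_def]

lemma opY_apply (i j : ℤ) (f : Conf → ℝ) (ω : Conf) :
    opY V i j f ω
      = (ω i).1 * siteDeriv (0, 1) j f ω - deriv V (ω j).2 * siteDeriv (1, 0) i f ω := by
  rw [opY, dP_eq_siteDeriv, dR_eq_siteDeriv]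

lemma update_shift (j i : ℤ) (ω : Conf) (x : ℝ × ℝ) :
    (fun k => Function.update ω i x (k + j)) = Function.update (fun k => ω (k + j)) (i - j) x := by
  funext k
  by_cases hk : k = i - j
  · subst hk
    simp
  · rw [Function.update_of_ne hk, Function.update_of_ne (by lia)]

lemma siteDeriv_shift (v : ℝ × ℝ) (i j : ℤ) (f : Conf → ℝ) :
    siteDeriv v i (shift j f) = shift j (siteDeriv v (i - j) f) := by
  funext ω
  simp [siteDeriv, shift, update_shift]

lemma opY_shift (i j k : ℤ) (f : Conf → ℝ) :
    opY V i j (shift k f) = shift k (opY V (i - k) (j - k) f) := by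
  funext ω
  simp [opY_apply, siteDeriv_shift, shift]

lemma siteDeriv_const (v : ℝ × ℝ) (i : ℤ) (c : ℝ) : siteDeriv v i (fun _ => c) = fun _ => 0 := by
  funext ω
  simp [siteDeriv, lineDeriv]

lemma siteDeriv_eq_zero_of_dependsOn {s : Set ℤ} (hf : DependsOn f s) {i : ℤ} (hi : i ∉ s)
    (v : ℝ × ℝ) : siteDeriv v i f = fun _ => 0 := by
  funext ω
  have update_eq : ∀ x, f (Function.update ω i x) = f ω := fun x =>
    hf fun _ hk => Function.update_of_ne (ne_of_mem_of_not_mem hk hi) _ _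
  simp [siteDeriv, lineDeriv, update_eq]

lemma opY_eq_zero_of_dependsOn {s : Set ℤ} (hf : DependsOn f s) {i j : ℤ} (hi : i ∉ s)
    (hj : j ∉ s) : opY V i j f = fun _ => 0 := by
  funext ω
  simp [opY_apply, siteDeriv_eq_zero_of_dependsOn hf hi, siteDeriv_eq_zero_of_dependsOn hf hj]

lemma siteDeriv_eval (φ : ℝ × ℝ → ℝ) (v : ℝ × ℝ) (i j : ℤ) :
    siteDeriv v j (fun ω => φ (ω i)) = fun ω => if i = j then lineDeriv ℝ φ (ω i) v else 0 := by
  funext ω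
  by_cases hij : i = j
  · subst hij
    simp [siteDeriv]
  · simp [siteDeriv, hij, lineDeriv]

lemma lineDeriv_comp_fst {φ : ℝ → ℝ} (hφ : Differentiable ℝ φ) (x v : ℝ × ℝ) :
    lineDeriv ℝ (fun y : ℝ × ℝ => φ y.1) x v = v.1 * deriv φ x.1 := by
  have h := (hφ x.1).hasDerivAt.hasFDerivAt.comp x hasFDerivAt_fst
  simpa [Function.comp_def] using (h.hasLineDerivAt v).lineDeriv

lemma lineDeriv_comp_snd {φ : ℝ → ℝ} (hφ : Differentiable ℝ φ) (x v : ℝ × ℝ) :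
    lineDeriv ℝ (fun y : ℝ × ℝ => φ y.2) x v = v.2 * deriv φ x.2 := by
  have h := (hφ x.2).hasDerivAt.hasFDerivAt.comp x hasFDerivAt_snd
  simpa [Function.comp_def] using (h.hasLineDerivAt v).lineDeriv

lemma opY_comp_p {φ : ℝ → ℝ} (hφ : Differentiable ℝ φ) (i j k : ℤ) :
    opY V i j (fun ω => φ (ω k).1)
      = fun ω => if k = i then -(deriv V (ω j).2 * deriv φ (ω i).1) else 0 := by
  funext ω
  rw [opY_apply, siteDeriv_eval fun x => φ x.1, siteDeriv_eval fun x => φ x.1]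
  simp only [lineDeriv_comp_fst hφ]
  split_ifs <;> simp_all

lemma opY_comp_r {φ : ℝ → ℝ} (hφ : Differentiable ℝ φ) (i j k : ℤ) :
    opY V i j (fun ω => φ (ω k).2)
      = fun ω => if k = j then (ω i).1 * deriv φ (ω j).2 else 0 := by
  funext ω
  rw [opY_apply, siteDeriv_eval fun x => φ x.2, siteDeriv_eval fun x => φ x.2]
  simp only [lineDeriv_comp_snd hφ]
  split_ifs <;> simp_all

end SiteDeriv

section SiteDifferentiable

variable {V : ℝ → ℝ} {f g : Conf → ℝ}

/-- `f` is differentiable in the coordinates of each site. -/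
def SiteDifferentiable (f : Conf → ℝ) : Prop :=
  ∀ (i : ℤ) (ω : Conf), Differentiable ℝ fun x => f (Function.update ω i x)

namespace SiteDifferentiable

lemma const (c : ℝ) : SiteDifferentiable fun _ => c := fun _ _ => differentiable_const c

lemma add (hf : SiteDifferentiable f) (hg : SiteDifferentiable g) :
    SiteDifferentiable fun ω => f ω + g ω :=
  fun i ω => (hf i ω).add (hg i ω)

lemma mul (hf : SiteDifferentiable f) (hg : SiteDifferentiable g) :
    SiteDifferentiable fun ω => f ω * g ω :=
  fun i ω => (hf i ω).mul (hg i ω)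

lemma sum {ι : Type*} (s : Finset ι) {F : ι → Conf → ℝ} (hF : ∀ a ∈ s, SiteDifferentiable (F a)) :
    SiteDifferentiable fun ω => ∑ a ∈ s, F a ω :=
  fun i ω => Differentiable.fun_sum fun a ha => hF a ha i ω

lemma eval {φ : ℝ × ℝ → ℝ} (hφ : Differentiable ℝ φ) (i : ℤ) :
    SiteDifferentiable fun ω => φ (ω i) := by
  intro j ω
  by_cases hij : i = j
  · subst hij
    simpa using hφ
  · simp [hij]

lemma shift (hf : SiteDifferentiable f) (j : ℤ) : SiteDifferentiable (shift j f) := by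
  intro i ω
  simpa [AnharmonicChain.shift, update_shift] using hf (i - j) fun k => ω (k + j)

lemma hasLineDerivAt_update (hf : SiteDifferentiable f) (v : ℝ × ℝ) (i : ℤ) (ω : Conf)
    (x : ℝ × ℝ) : HasLineDerivAt ℝ (fun y => f (Function.update ω i y))
      (siteDeriv v i f (Function.update ω i x)) x v := by
  simpa [siteDeriv] using (hf i ω x).lineDifferentiableAt.hasLineDerivAt (v := v)

lemma siteDeriv_add (hf : SiteDifferentiable f) (hg : SiteDifferentiable g) (v : ℝ × ℝ) (i : ℤ) :
    siteDeriv v i (fun ω => f ω + g ω) = fun ω => siteDeriv v i f ω + siteDeriv v i g ω := by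
  funext ω
  simpa [siteDeriv, lineDeriv] using
    (HasDerivAt.fun_add (hf.hasLineDerivAt_update v i ω (ω i))
      (hg.hasLineDerivAt_update v i ω (ω i))).deriv

lemma siteDeriv_mul (hf : SiteDifferentiable f) (hg : SiteDifferentiable g) (v : ℝ × ℝ) (i : ℤ) :
    siteDeriv v i (fun ω => f ω * g ω)
      = fun ω => siteDeriv v i f ω * g ω + f ω * siteDeriv v i g ω := by
  funext ω
  simpa [siteDeriv, lineDeriv] using
    (HasDerivAt.fun_mul (hf.hasLineDerivAt_update v i ω (ω i))
      (hg.hasLineDerivAt_update v i ω (ω i))).deriv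

lemma opY_add (hf : SiteDifferentiable f) (hg : SiteDifferentiable g) (i j : ℤ) :
    opY V i j (fun ω => f ω + g ω) = fun ω => opY V i j f ω + opY V i j g ω := by
  funext ω
  simp only [opY_apply, hf.siteDeriv_add hg]
  ring

lemma opY_mul (hf : SiteDifferentiable f) (hg : SiteDifferentiable g) (i j : ℤ) :
    opY V i j (fun ω => f ω * g ω) = fun ω => opY V i j f ω * g ω + f ω * opY V i j g ω := by
  funext ω
  simp only [opY_apply, hf.siteDeriv_mul hg]
  ring

end SiteDifferentiable

lemma opY_const (i j : ℤ) (c : ℝ) : opY V i j (fun _ => c) = fun _ => 0 := by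
  funext ω
  simp [opY_apply, siteDeriv_const]

namespace SiteDifferentiable

lemma opY_const_mul (hf : SiteDifferentiable f) (c : ℝ) (i j : ℤ) :
    opY V i j (fun ω => c * f ω) = fun ω => c * opY V i j f ω := by
  rw [(const c).opY_mul hf]
  simp [opY_const]

lemma opY_sum {ι : Type*} (s : Finset ι) {F : ι → Conf → ℝ}
    (hF : ∀ a ∈ s, SiteDifferentiable (F a)) (i j : ℤ) :
    opY V i j (fun ω => ∑ a ∈ s, F a ω) = fun ω => ∑ a ∈ s, opY V i j (F a) ω := by
  classical
  induction s using Finset.induction_on with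
  | empty => simp [opY_const]
  | insert a s ha ih =>
    simp only [Finset.sum_insert ha]
    rw [(hF a (by simp)).opY_add (sum s fun b hb => hF b (by simp [hb])),
      ih fun b hb => hF b (by simp [hb])]

end SiteDifferentiable

end SiteDifferentiable

/-! ### Tame functions and integration by parts -/

section Tame

variable {V : ℝ → ℝ} {β : ℝ} {f g : Conf → ℝ}

/-- The class of functions on which integration by parts is carried out: functions differentiable
in the coordinates of each site which, together with these derivatives, have all moments under
`ν_β`. -/
structure Tame (V : ℝ → ℝ) (β : ℝ) (f : Conf → ℝ) : Prop where
  hasAllMoments : HasAllMoments f (gibbs V β)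
  hasAllMoments_siteDeriv : ∀ v i, HasAllMoments (siteDeriv v i f) (gibbs V β)
  siteDifferentiable : SiteDifferentiable f

namespace Tame

lemma add (hf : Tame V β f) (hg : Tame V β g) : Tame V β fun ω => f ω + g ω where
  hasAllMoments := hf.hasAllMoments.add hg.hasAllMoments
  hasAllMoments_siteDeriv v i := by
    rw [hf.siteDifferentiable.siteDeriv_add hg.siteDifferentiable]
    exact (hf.hasAllMoments_siteDeriv v i).add (hg.hasAllMoments_siteDeriv v i)
  siteDifferentiable := hf.siteDifferentiable.add hg.siteDifferentiable

lemma mul (hf : Tame V β f) (hg : Tame V β g) : Tame V β fun ω => f ω * g ω where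
  hasAllMoments := hf.hasAllMoments.mul hg.hasAllMoments
  hasAllMoments_siteDeriv v i := by
    rw [hf.siteDifferentiable.siteDeriv_mul hg.siteDifferentiable]
    exact ((hf.hasAllMoments_siteDeriv v i).mul hg.hasAllMoments).add
      (hf.hasAllMoments.mul (hg.hasAllMoments_siteDeriv v i))
  siteDifferentiable := hf.siteDifferentiable.mul hg.siteDifferentiable

variable [hV : IsConvexPotential V] [Fact (0 < β)]

lemma const (c : ℝ) : Tame V β fun _ => c where
  hasAllMoments := HasAllMoments.const c
  hasAllMoments_siteDeriv v i := by
    rw [siteDeriv_const]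
    exact HasAllMoments.const 0
  siteDifferentiable := SiteDifferentiable.const c

lemma const_mul (hf : Tame V β f) (c : ℝ) : Tame V β fun ω => c * f ω := (const c).mul hf

lemma sub (hf : Tame V β f) (hg : Tame V β g) : Tame V β fun ω => f ω - g ω := by
  simpa [sub_eq_add_neg] using hf.add (hg.const_mul (-1))

lemma sum {ι : Type*} (s : Finset ι) {F : ι → Conf → ℝ} (hF : ∀ a ∈ s, Tame V β (F a)) :
    Tame V β fun ω => ∑ a ∈ s, F a ω := by
  classical
  induction s using Finset.induction_on with
  | empty => simpa using const (V := V) (β := β) 0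
  | insert a s ha ih =>
    simp only [Finset.sum_insert ha]
    exact (hF a (by simp)).add (ih fun b hb => hF b (by simp [hb]))

lemma shift (hf : Tame V β f) (j : ℤ) : Tame V β (shift j f) where
  hasAllMoments := hasAllMoments_shift hf.hasAllMoments j
  hasAllMoments_siteDeriv v i := by
    rw [siteDeriv_shift]
    exact hasAllMoments_shift (hf.hasAllMoments_siteDeriv v _) j
  siteDifferentiable := hf.siteDifferentiable.shift j

lemma eval {φ : ℝ × ℝ → ℝ} (hφ : Differentiable ℝ φ) (hφ_mom : HasAllMoments φ (siteMeasure V β))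
    (hφ'_mom : ∀ v, HasAllMoments (fun x => lineDeriv ℝ φ x v) (siteMeasure V β)) (i : ℤ) :
    Tame V β fun ω => φ (ω i) where
  hasAllMoments := hφ_mom.comp_measurePreserving (measurePreserving_eval i)
  hasAllMoments_siteDeriv v j := by
    rw [siteDeriv_eval]
    split_ifs
    · exact (hφ'_mom v).comp_measurePreserving (measurePreserving_eval i)
    · exact HasAllMoments.const 0
  siteDifferentiable := SiteDifferentiable.eval hφ i

lemma p (i : ℤ) : Tame V β fun ω => (ω i).1 := by
  refine eval (φ := Prod.fst) differentiable_fst hasAllMoments_p (fun v => ?_) i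
  simpa [lineDeriv_comp_fst (φ := fun x => x) differentiable_fun_id] using
    HasAllMoments.const (μ := siteMeasure V β) v.1

lemma comp_r {φ : ℝ → ℝ} (hφ : Differentiable ℝ φ)
    (hφ_mom : HasAllMoments (fun x => φ x.2) (siteMeasure V β))
    (hφ'_mom : HasAllMoments (fun x => deriv φ x.2) (siteMeasure V β)) (i : ℤ) :
    Tame V β fun ω => φ (ω i).2 := by
  refine eval (φ := fun x => φ x.2) (hφ.comp differentiable_snd) hφ_mom (fun v => ?_) i
  simpa only [lineDeriv_comp_snd hφ] using hφ'_mom.const_mul v.2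

lemma potential (i : ℤ) : Tame V β fun ω => V (ω i).2 :=
  comp_r hV.differentiable hasAllMoments_potential hasAllMoments_force i

lemma force (i : ℤ) : Tame V β fun ω => deriv V (ω i).2 :=
  comp_r hV.differentiable_deriv hasAllMoments_force hasAllMoments_deriv_force i

lemma p_sq (i : ℤ) : Tame V β fun ω => (ω i).1 ^ 2 := by
  simpa [sq] using (p i).mul (p i)

lemma energy (i : ℤ) : Tame V β (energy V i) := by
  have kinetic_add_potential := ((p_sq (V := V) (β := β) i).const_mul 2⁻¹).add (potential i)
  simpa only [inv_mul_eq_div] using! kinetic_add_potential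

lemma opY_hasAllMoments (hf : Tame V β f) (i j : ℤ) : HasAllMoments (opY V i j f) (gibbs V β) := by
  unfold opY
  rw [dP_eq_siteDeriv, dR_eq_siteDeriv]
  exact ((p i).hasAllMoments.mul (hf.hasAllMoments_siteDeriv _ j)).sub
    ((force j).hasAllMoments.mul (hf.hasAllMoments_siteDeriv _ i))

end Tame

variable [hV : IsConvexPotential V] [Fact (0 < β)]

lemma avg_siteDeriv (hf : Tame V β f) (v : ℝ × ℝ) (i : ℤ) :
    avg V β (siteDeriv v i f)
      = β * avg V β fun ω => (v.1 * (ω i).1 + v.2 * deriv V (ω i).2) * f ω :=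
  avg_lineDeriv i (fun ω x => hf.siteDifferentiable.hasLineDerivAt_update v i ω x)
    hf.hasAllMoments.integrable (hf.hasAllMoments_siteDeriv v i).integrable
    (((((Tame.p i).const_mul v.1).add ((Tame.force i).const_mul v.2)).mul hf
      ).hasAllMoments.integrable)

lemma avg_p_mul (hf : Tame V β f) (i : ℤ) :
    β * avg V β (fun ω => (ω i).1 * f ω) = avg V β (siteDeriv (1, 0) i f) := by
  simp [avg_siteDeriv hf]

lemma avg_force_mul (hf : Tame V β f) (i : ℤ) :
    β * avg V β (fun ω => deriv V (ω i).2 * f ω) = avg V β (siteDeriv (0, 1) i f) := by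
  simp [avg_siteDeriv hf]

lemma avg_opY (hf : Tame V β f) (i j : ℤ) : avg V β (opY V i j f) = 0 := by
  have deriv_r : siteDeriv (0, 1) j (fun ω => (ω i).1 * f ω)
      = fun ω => (ω i).1 * siteDeriv (0, 1) j f ω := by
    rw [(Tame.p (V := V) (β := β) i).siteDifferentiable.siteDeriv_mul hf.siteDifferentiable,
      siteDeriv_eval Prod.fst]
    simp [lineDeriv_comp_fst (φ := fun x => x) differentiable_fun_id]
  have deriv_p : siteDeriv (1, 0) i (fun ω => deriv V (ω j).2 * f ω)
      = fun ω => deriv V (ω j).2 * siteDeriv (1, 0) i f ω := by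
    rw [(Tame.force (V := V) (β := β) j).siteDifferentiable.siteDeriv_mul hf.siteDifferentiable,
      siteDeriv_eval fun x => deriv V x.2]
    simp [lineDeriv_comp_snd hV.differentiable_deriv]
  have by_parts_r := avg_force_mul ((Tame.p i).mul hf) j
  have by_parts_p := avg_p_mul ((Tame.force j).mul hf) i
  rw [deriv_r] at by_parts_r
  rw [deriv_p] at by_parts_p
  rw [funext (opY_apply (V := V) i j f),
    avg_sub ((Tame.p i).hasAllMoments.mul (hf.hasAllMoments_siteDeriv _ j))
      ((Tame.force j).hasAllMoments.mul (hf.hasAllMoments_siteDeriv _ i)),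
    ← by_parts_r, ← by_parts_p, sub_eq_zero]
  simp only [mul_left_comm]

lemma avg_mul_opY (hf : Tame V β f) (hg : Tame V β g) (i j : ℤ) :
    avg V β (fun ω => f ω * opY V i j g ω) = -avg V β (fun ω => opY V i j f ω * g ω) := by
  have leibniz := avg_opY (hf.mul hg) i j
  rw [hf.siteDifferentiable.opY_mul hg.siteDifferentiable,
    avg_add ((hf.opY_hasAllMoments i j).mul hg.hasAllMoments)
      (hf.hasAllMoments.mul (hg.opY_hasAllMoments i j))] at leibniz
  linarith

end Tame

/-! ### Test functions and the formal sum `Γ` -/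

section IsTest

variable {V : ℝ → ℝ} {β : ℝ} {f : Conf → ℝ} {Λ : Finset ℤ}

/-- `f` is a smooth local function with compact support in the coordinates of `Λ`; the elements of
`𝒞` are the functions of this kind, for some `Λ`, that have zero average. -/
def IsTest (Λ : Finset ℤ) (f : Conf → ℝ) : Prop :=
  ∃ φ : (Λ → ℝ × ℝ) → ℝ, ContDiff ℝ ((⊤ : ℕ∞) : WithTop ℕ∞) φ ∧ HasCompactSupport φ ∧
    ∀ ω : Conf, f ω = φ fun i => ω i

lemma hasFDerivAt_restrict_update (Λ : Finset ℤ) (i : ℤ) (ω : Conf) (x : ℝ × ℝ) :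
    HasFDerivAt (fun y (k : Λ) => Function.update ω i y k)
      (ContinuousLinearMap.pi fun k : Λ =>
        if (k : ℤ) = i then ContinuousLinearMap.id ℝ (ℝ × ℝ) else 0) x := by
  refine hasFDerivAt_pi.2 fun k => ?_
  by_cases hk : (k : ℤ) = i
  · subst hk
    simpa using! hasFDerivAt_id x
  · simpa [hk] using hasFDerivAt_const (ω k) x

lemma siteDeriv_comp_restrict {φ : (Λ → ℝ × ℝ) → ℝ} (hφ : Differentiable ℝ φ) (v : ℝ × ℝ) (i : ℤ)
    (ω : Conf) :
    siteDeriv v i (fun ω => φ fun k => ω k) ω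
      = fderiv ℝ φ (fun k => ω k) fun k => if (k : ℤ) = i then v else 0 := by
  have chain_rule := ((hφ _).hasFDerivAt.comp (ω i)
    (hasFDerivAt_restrict_update Λ i ω (ω i))).hasLineDerivAt v
  refine chain_rule.lineDeriv.trans ?_
  rw [Function.update_eq_self]
  refine congrArg (fderiv ℝ φ fun k : Λ => ω k) (funext fun k => ?_)
  by_cases hk : (k : ℤ) = i <;> simp [hk]

/-- `f` is a smooth function of the coordinates of `Λ`. -/
def IsSmoothLocal (Λ : Finset ℤ) (f : Conf → ℝ) : Prop :=
  ∃ φ : (Λ → ℝ × ℝ) → ℝ, ContDiff ℝ ((⊤ : ℕ∞) : WithTop ℕ∞) φ ∧ ∀ ω : Conf, f ω = φ fun i => ω i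

lemma IsSmoothLocal.dependsOn (hf : IsSmoothLocal Λ f) : DependsOn f (Λ : Set ℤ) := by
  obtain ⟨φ, -, f_eq⟩ := hf
  intro ω ω' hω
  rw [f_eq, f_eq]
  congr 1
  funext i
  exact hω i i.2

lemma IsSmoothLocal.siteDifferentiable (hf : IsSmoothLocal Λ f) : SiteDifferentiable f := by
  obtain ⟨φ, φ_smooth, f_eq⟩ := hf
  intro i ω x
  simpa only [f_eq] using! (φ_smooth.differentiable (by simp) _).comp x
    (hasFDerivAt_restrict_update Λ i ω x).differentiableAt

namespace IsTest

lemma isSmoothLocal (hf : IsTest Λ f) : IsSmoothLocal Λ f := by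
  obtain ⟨φ, φ_smooth, -, f_eq⟩ := hf
  exact ⟨φ, φ_smooth, f_eq⟩

lemma dependsOn (hf : IsTest Λ f) : DependsOn f (Λ : Set ℤ) := hf.isSmoothLocal.dependsOn

lemma siteDifferentiable (hf : IsTest Λ f) : SiteDifferentiable f :=
  hf.isSmoothLocal.siteDifferentiable

lemma siteDeriv (hf : IsTest Λ f) (v : ℝ × ℝ) (i : ℤ) : IsTest Λ (siteDeriv v i f) := by
  obtain ⟨φ, φ_smooth, φ_supp, f_eq⟩ := hf
  refine ⟨fun x => fderiv ℝ φ x fun k => if (k : ℤ) = i then v else 0,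
    (contDiff_infty_iff_fderiv.1 φ_smooth).2.clm_apply contDiff_const,
    φ_supp.fderiv_apply (𝕜 := ℝ) _, fun ω => ?_⟩
  rw [funext f_eq]
  exact siteDeriv_comp_restrict (φ_smooth.differentiable (by simp)) v i ω

variable [IsConvexPotential V] [Fact (0 < β)]

lemma hasAllMoments (hf : IsTest Λ f) : HasAllMoments f (gibbs V β) := by
  obtain ⟨φ, φ_smooth, φ_supp, f_eq⟩ := hf
  obtain ⟨C, φ_le⟩ := φ_supp.exists_bound_of_continuous φ_smooth.continuous
  have f_measurable : Measurable f := by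
    rw [funext f_eq]
    exact φ_smooth.continuous.measurable.comp (by fun_prop)
  exact (HasAllMoments.const C).mono f_measurable.aestronglyMeasurable fun ω => by
    rw [f_eq]
    exact φ_le _

lemma tame (hf : IsTest Λ f) : Tame V β f where
  hasAllMoments := hf.hasAllMoments
  hasAllMoments_siteDeriv v i := (hf.siteDeriv v i).hasAllMoments
  siteDifferentiable := hf.siteDifferentiable

lemma tame_opY (hf : IsTest Λ f) (i j : ℤ) : Tame V β (opY V i j f) := by
  rw [funext (opY_apply i j f)]
  exact ((Tame.p i).mul (hf.siteDeriv _ j).tame).sub ((Tame.force j).mul (hf.siteDeriv _ i).tame)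

end IsTest

end IsTest

section Gradient

variable {V : ℝ → ℝ} {β : ℝ} {f g : Conf → ℝ} {Λ : Finset ℤ} {e : ℤ}

/-- The sites `k` such that `k` or `k + 1` belongs to `Λ`, that is, those for which `X_k` or
`Y_{k,k+1}` can act non-trivially on a function of the coordinates of `Λ`. -/
def bondSupport (Λ : Finset ℤ) : Finset ℤ := Λ ∪ Λ.image fun k => k - 1

lemma opY_eq_zero_of_notMem_bondSupport (hf : DependsOn f (Λ : Set ℤ)) (he : e = 0 ∨ e = 1)
    {k : ℤ} (hk : k ∉ bondSupport Λ) : opY V k (k + e) f = fun _ => 0 := by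
  simp only [bondSupport, Finset.mem_union, Finset.mem_image, not_or, not_exists, not_and] at hk
  refine opY_eq_zero_of_dependsOn hf (by simpa using hk.1) ?_
  rcases he with rfl | rfl
  · simpa using hk.1
  · exact fun hk' => hk.2 (k + 1) hk' (by ring)

lemma opL_eq_sum (γ : ℝ) (hf : DependsOn f (Λ : Set ℤ)) :
    opL V γ f = fun ω =>
      ∑ k ∈ bondSupport Λ, (γ / 2 * opY V k (k + 0) (opY V k (k + 0) f) ω
        + 1 * opY V k (k + 0) f ω)
      + ∑ k ∈ bondSupport Λ, (γ / 2 * opY V k (k + 1) (opY V k (k + 1) f) ω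
        + -1 * opY V k (k + 1) f ω) := by
  have opX_zero : ∀ k ∉ bondSupport Λ, opY V k k f = fun _ => 0 := fun k hk => by
    simpa using opY_eq_zero_of_notMem_bondSupport (V := V) hf (Or.inl rfl) hk
  have opY_zero : ∀ k ∉ bondSupport Λ, opY V k (k + 1) f = fun _ => 0 := fun k hk =>
    opY_eq_zero_of_notMem_bondSupport hf (Or.inr rfl) hk
  funext ω
  have opS_eq : opS V γ f ω = γ / 2 * ∑ k ∈ bondSupport Λ,
      (opY V k k (opY V k k f) ω + opY V k (k + 1) (opY V k (k + 1) f) ω) := by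
    refine congrArg _ (finsum_eq_sum_of_support_subset _ fun k hk => ?_)
    by_contra hk'
    exact hk (by simp [opX, opX_zero k hk', opY_zero k hk', opY_const])
  have opA_eq : opA V f ω = ∑ k ∈ bondSupport Λ, (opY V k k f ω - opY V k (k + 1) f ω) := by
    refine finsum_eq_sum_of_support_subset _ fun k hk => ?_
    by_contra hk'
    exact hk (by simp [opX, opX_zero k hk', opY_zero k hk'])
  rw [opL, opS_eq, opA_eq, Finset.mul_sum, ← Finset.sum_add_distrib, ← Finset.sum_add_distrib]
  refine Finset.sum_congr rfl fun k _ => ?_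
  rw [add_zero]
  ring

/-- `Y_{0,e} Γ_g`; this is `XGamma` for `e = 0` and `YGamma` for `e = 1`. -/
def gradGamma (V : ℝ → ℝ) (e : ℤ) (g : Conf → ℝ) : Conf → ℝ := fun ω =>
  ∑ᶠ j : ℤ, opY V 0 e (shift j g) ω

/-- The part `∑_{k ∈ K} τ_{-k} f` of the formal sum `Γ_f`. -/
def partialGamma (K : Finset ℤ) (f : Conf → ℝ) : Conf → ℝ := fun ω => ∑ k ∈ K, shift (-k) f ω

lemma opY_shift_neg (i k e : ℤ) (g : Conf → ℝ) :
    opY V k (k + e) (shift (-i) g) = shift (-i) (opY V (i + k) (i + k + e) g) := by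
  rw [opY_shift, show k - -i = i + k by ring, show k + e - -i = i + k + e by ring]

lemma gradGamma_eq_sum (hg : DependsOn g (Λ : Set ℤ)) (he : e = 0 ∨ e = 1) :
    gradGamma V e g = fun ω => ∑ k ∈ bondSupport Λ, shift (-k) (opY V k (k + e) g) ω := by
  funext ω
  have reindex : gradGamma V e g ω = ∑ᶠ k : ℤ, shift (-k) (opY V k (k + e) g) ω := by
    rw [gradGamma, ← finsum_comp_equiv (Equiv.neg ℤ)]
    simp [opY_shift, add_comm]
  rw [reindex]
  refine finsum_eq_sum_of_support_subset _ fun k hk => ?_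
  by_contra k_notMem
  exact hk (by simp [opY_eq_zero_of_notMem_bondSupport hg he k_notMem, shift])

lemma sum_opY_shift_neg (hg : DependsOn g (Λ : Set ℤ)) {e : ℤ} (he : e = 0 ∨ e = 1) (k : ℤ) :
    (fun ω => ∑ i ∈ (bondSupport Λ).image fun m => m - k, opY V k (k + e) (shift (-i) g) ω)
      = shift k (gradGamma V e g) := by
  rw [gradGamma_eq_sum hg he]
  funext ω
  rw [Finset.sum_image fun a _ b _ hab => by simpa using hab]
  refine Finset.sum_congr rfl fun m _ => ?_
  rw [opY_shift_neg, sub_add_cancel, neg_sub, sub_eq_add_neg, ← shift_shift]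
  rfl

lemma gradGamma_eq_opY (hg : DependsOn g (Λ : Set ℤ)) (hg_diff : SiteDifferentiable g)
    (he : e = 0 ∨ e = 1) : gradGamma V e g = opY V 0 e (partialGamma (bondSupport Λ) g) := by
  unfold partialGamma
  rw [gradGamma_eq_sum hg he, SiteDifferentiable.opY_sum _ fun k _ => hg_diff.shift (-k)]
  simp [opY_shift, add_comm]

variable [IsConvexPotential V] [Fact (0 < β)]

lemma Tame.partialGamma (hf : Tame V β f) (K : Finset ℤ) : Tame V β (partialGamma K f) :=
  Tame.sum K fun k _ => hf.shift (-k)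

lemma hasAllMoments_gradGamma (hg : DependsOn g (Λ : Set ℤ)) (hg_tame : Tame V β g)
    (he : e = 0 ∨ e = 1) : HasAllMoments (gradGamma V e g) (gibbs V β) := by
  rw [gradGamma_eq_opY hg hg_tame.siteDifferentiable he]
  exact (hg_tame.partialGamma _).opY_hasAllMoments 0 e

end Gradient

/-! ### Pairings with `W_{0,1} + κ (p_1² - p_0²) - L F` -/

section Pairing

variable {V : ℝ → ℝ} {β : ℝ} {f g : Conf → ℝ} {Λ : Finset ℤ} {u : ℤ → Conf → ℝ}

/-- `f` has all moments, and the sum `∑_i ⟨u_i f⟩`, which represents `⟨Γ f⟩` for the formal sum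
`Γ = ∑_i u_i`, has finitely many nonzero terms and equals `s`. -/
structure HasPairing (V : ℝ → ℝ) (β : ℝ) (u : ℤ → Conf → ℝ) (f : Conf → ℝ) (s : ℝ) :
    Prop where
  hasAllMoments : HasAllMoments f (gibbs V β)
  finite_support : (Function.support fun i => avg V β fun ω => u i ω * f ω).Finite
  finsum_eq : ∑ᶠ i, avg V β (fun ω => u i ω * f ω) = s

namespace HasPairing

lemma add {s t : ℝ} (hu : ∀ i, HasAllMoments (u i) (gibbs V β)) (hf : HasPairing V β u f s)
    (hg : HasPairing V β u g t) : HasPairing V β u (fun ω => f ω + g ω) (s + t) := by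
  have terms : (fun i => avg V β fun ω => u i ω * (f ω + g ω))
      = fun i => avg V β (fun ω => u i ω * f ω) + avg V β (fun ω => u i ω * g ω) := by
    funext i
    rw [← avg_add ((hu i).mul hf.hasAllMoments) ((hu i).mul hg.hasAllMoments)]
    simp only [mul_add]
  refine ⟨hf.hasAllMoments.add hg.hasAllMoments, ?_, ?_⟩
  · rw [terms]
    exact (hf.finite_support.union hg.finite_support).subset (Function.support_add _ _)
  · rw [terms, finsum_add_distrib hf.finite_support hg.finite_support, hf.finsum_eq, hg.finsum_eq]

lemma const_mul {s : ℝ} (hf : HasPairing V β u f s) (c : ℝ) :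
    HasPairing V β u (fun ω => c * f ω) (c * s) := by
  have terms : (fun i => avg V β fun ω => u i ω * (c * f ω))
      = fun i => c * avg V β (fun ω => u i ω * f ω) := by
    funext i
    rw [← avg_const_mul]
    simp only [mul_left_comm]
  refine ⟨hf.hasAllMoments.const_mul c, ?_, ?_⟩
  · rw [terms]
    exact hf.finite_support.subset fun i hi => right_ne_zero_of_mul hi
  · rw [terms, ← mul_finsum' _ _ hf.finite_support, hf.finsum_eq]

lemma sub {s t : ℝ} (hu : ∀ i, HasAllMoments (u i) (gibbs V β)) (hf : HasPairing V β u f s)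
    (hg : HasPairing V β u g t) : HasPairing V β u (fun ω => f ω - g ω) (s - t) := by
  simpa [sub_eq_add_neg] using hf.add hu (hg.const_mul (-1))

variable [IsConvexPotential V] [Fact (0 < β)]

lemma sum {ι : Type*} (hu : ∀ i, HasAllMoments (u i) (gibbs V β)) (K : Finset ι)
    {F : ι → Conf → ℝ} {t : ι → ℝ} (hF : ∀ k ∈ K, HasPairing V β u (F k) (t k)) :
    HasPairing V β u (fun ω => ∑ k ∈ K, F k ω) (∑ k ∈ K, t k) := by
  classical
  induction K using Finset.induction_on with
  | empty => exact ⟨by simpa using HasAllMoments.const 0, by simp [avg_const], by simp [avg_const]⟩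
  | insert a K ha ih =>
    simp only [Finset.sum_insert ha]
    exact (hF a (by simp)).add hu (ih fun k hk => hF k (by simp [hk]))

lemma opY (hu : ∀ i, Tame V β (u i)) (hf : Tame V β f) (k l : ℤ) (K : Finset ℤ)
    (hK : ∀ i ∉ K, opY V k l (u i) = fun _ => 0) :
    HasPairing V β u (opY V k l f)
      (-avg V β fun ω => (∑ i ∈ K, AnharmonicChain.opY V k l (u i) ω) * f ω) := by
  have terms : (fun i => avg V β fun ω => u i ω * AnharmonicChain.opY V k l f ω)
      = fun i => -avg V β (fun ω => AnharmonicChain.opY V k l (u i) ω * f ω) :=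
    funext fun i => avg_mul_opY (hu i) hf k l
  have support_subset :
      (Function.support fun i =>
        -avg V β (fun ω => AnharmonicChain.opY V k l (u i) ω * f ω)) ⊆ K := by
    intro i hi
    by_contra hiK
    exact hi (by simp [hK i hiK, avg_const])
  refine ⟨hf.opY_hasAllMoments k l, ?_, ?_⟩
  · rw [terms]
    exact K.finite_toSet.subset support_subset
  · rw [terms, finsum_eq_sum_of_support_subset _ support_subset, Finset.sum_neg_distrib]
    simp only [Finset.sum_mul]
    rw [avg_sum]
    exact fun i _ => ((hu i).opY_hasAllMoments k l).mul hf.hasAllMoments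

end HasPairing

/-- The formal sum `Γ = ∑_i u_i` has the shift-covariant gradient `Y_{k,k+e} Γ = τ_k v_e`, for
`e = 0` and `e = 1`, in the weak sense: `⟨Γ Y_{k,k+e} f⟩ = -⟨(τ_k v_e) f⟩`. -/
structure HasGradient (V : ℝ → ℝ) (β : ℝ) (u : ℤ → Conf → ℝ) (v : ℤ → Conf → ℝ) : Prop where
  tame : ∀ i, Tame V β (u i)
  hasAllMoments : ∀ e : ℤ, e = 0 ∨ e = 1 → HasAllMoments (v e) (gibbs V β)
  hasPairing : ∀ f, Tame V β f → ∀ k e : ℤ, e = 0 ∨ e = 1 →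
    HasPairing V β u (opY V k (k + e) f) (-avg V β fun ω => v e ω * shift (-k) f ω)

variable [hV : IsConvexPotential V] [hβ : Fact (0 < β)]

lemma avg_mul_shift (f g : Conf → ℝ) (j : ℤ) :
    avg V β (fun ω => f ω * shift j g ω) = avg V β fun ω => shift (-j) f ω * g ω := by
  calc avg V β (fun ω => f ω * shift j g ω)
      = avg V β (shift (-j) fun ω => f ω * shift j g ω) := (avg_shift (-j) _).symm
    _ = avg V β fun ω => shift (-j) f ω * shift (-j) (shift j g) ω := rfl
    _ = avg V β fun ω => shift (-j) f ω * g ω := by rw [shift_shift, neg_add_cancel, shift_zero]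

lemma hasGradient_shift (hg : DependsOn g (Λ : Set ℤ)) (hg_tame : Tame V β g) :
    HasGradient V β (fun i => shift (-i) g) (fun e => gradGamma V e g) where
  tame i := hg_tame.shift (-i)
  hasAllMoments e he := hasAllMoments_gradGamma hg hg_tame he
  hasPairing f hf k e he := by
    rw [avg_mul_shift, neg_neg, ← sum_opY_shift_neg hg he]
    refine HasPairing.opY (fun i => hg_tame.shift (-i)) hf k (k + e) _ fun i hi => ?_
    have notMem : i + k ∉ bondSupport Λ := fun hm =>
      hi (Finset.mem_image.2 ⟨i + k, hm, by ring⟩)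
    rw [opY_shift_neg, opY_eq_zero_of_notMem_bondSupport hg he notMem]
    rfl

lemma siteDeriv_energy (v : ℝ × ℝ) (i j : ℤ) :
    siteDeriv v j (energy V i)
      = fun ω => if i = j then v.1 * (ω i).1 + v.2 * deriv V (ω i).2 else 0 := by
  have kinetic_diff : Differentiable ℝ fun x : ℝ => x ^ 2 / 2 := by fun_prop
  have kinetic_siteDiff : SiteDifferentiable fun ω => (ω i).1 ^ 2 / 2 :=
    SiteDifferentiable.eval (φ := fun x => x.1 ^ 2 / 2) (by fun_prop) i
  have potential_siteDiff : SiteDifferentiable fun ω => V (ω i).2 :=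
    SiteDifferentiable.eval (hV.differentiable.comp differentiable_snd) i
  refine (kinetic_siteDiff.siteDeriv_add potential_siteDiff v j).trans ?_
  rw [siteDeriv_eval fun x => x.1 ^ 2 / 2, siteDeriv_eval fun x => V x.2]
  funext ω
  simp only [lineDeriv_comp_fst kinetic_diff, lineDeriv_comp_snd hV.differentiable]
  split_ifs <;> simp

lemma opY_energy (k l i : ℤ) :
    opY V k l (energy V i) = fun ω => (ω k).1 * deriv V (ω l).2 *
      ((if i = l then 1 else 0) - if i = k then 1 else 0) := by
  funext ω
  simp only [opY_apply, siteDeriv_energy, zero_mul, one_mul, zero_add, add_zero]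
  split_ifs <;> grind

lemma hasGradient_energy :
    HasGradient V β (fun i ω => (i : ℝ) * energy V i ω)
      (fun e ω => if e = 1 then (ω 0).1 * deriv V (ω 1).2 else 0) where
  tame i := (Tame.energy i).const_mul i
  hasAllMoments e he := by
    rcases he with rfl | rfl
    · simpa using HasAllMoments.const 0
    · simpa using ((Tame.p 0).mul (Tame.force 1)).hasAllMoments
  hasPairing f hf k e he := by
    have opY_term : ∀ i : ℤ, opY V k (k + e) (fun ω => (i : ℝ) * energy V i ω) = fun ω =>
        i * ((ω k).1 * deriv V (ω (k + e)).2 *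
          ((if i = k + e then 1 else 0) - if i = k then 1 else 0)) := fun i => by
      rw [(Tame.energy (V := V) (β := β) i).siteDifferentiable.opY_const_mul, opY_energy]
    convert HasPairing.opY (fun i => (Tame.energy i).const_mul (i : ℝ)) hf k (k + e)
      {k, k + 1} (fun i hi => ?_) using 2
    · rw [avg_mul_shift, neg_neg]
      congr! 3 with ω
      rw [Finset.sum_pair (by simp), opY_term, opY_term]
      rcases he with rfl | rfl
      · simp [shift]
      · simp only [shift, add_comm 1 k, zero_add, if_true, left_eq_add, add_eq_left, one_ne_zero,
          if_false, Int.cast_add, Int.cast_one]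
        ring
    · rw [opY_term]
      simp only [Finset.mem_insert, Finset.mem_singleton, not_or] at hi
      rcases he with rfl | rfl <;> simp [hi]

namespace HasGradient

variable {v : ℤ → Conf → ℝ}

lemma hasPairing_sum (hu : HasGradient V β u v) (hf : IsTest Λ f) {e : ℤ} (he : e = 0 ∨ e = 1)
    (b c : ℝ) :
    HasPairing V β u
      (fun ω => ∑ k ∈ bondSupport Λ, (b * opY V k (k + e) (opY V k (k + e) f) ω
        + c * opY V k (k + e) f ω))
      (-avg V β fun ω =>
        v e ω * (b * gradGamma V e f ω + c * partialGamma (bondSupport Λ) f ω)) := by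
  have u_moments : ∀ i, HasAllMoments (u i) (gibbs V β) := fun i => (hu.tame i).hasAllMoments
  convert HasPairing.sum u_moments (bondSupport Λ) fun k _ =>
    ((hu.hasPairing _ (hf.tame_opY k (k + e)) k e he).const_mul b).add u_moments
      ((hu.hasPairing _ hf.tame k e he).const_mul c) using 1
  have v_moments := hu.hasAllMoments e he
  have opY_moments : ∀ k, HasAllMoments (shift (-k) (opY V k (k + e) f)) (gibbs V β) := fun k =>
    hasAllMoments_shift (hf.tame_opY k (k + e)).hasAllMoments (-k)
  have f_moments : ∀ k, HasAllMoments (shift (-k) f) (gibbs V β) := fun k =>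
    hasAllMoments_shift hf.hasAllMoments (-k)
  have expand : (fun ω => v e ω * (b * gradGamma V e f ω + c * partialGamma (bondSupport Λ) f ω))
      = fun ω => ∑ k ∈ bondSupport Λ, (b * (v e ω * shift (-k) (opY V k (k + e) f) ω)
        + c * (v e ω * shift (-k) f ω)) := by
    funext ω
    rw [gradGamma_eq_sum hf.dependsOn he, partialGamma, Finset.sum_add_distrib]
    simp only [← Finset.mul_sum]
    ring
  rw [expand, avg_sum _ fun k _ => ((v_moments.mul (opY_moments k)).const_mul b).add
    ((v_moments.mul (f_moments k)).const_mul c), ← Finset.sum_neg_distrib]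
  refine Finset.sum_congr rfl fun k _ => ?_
  rw [avg_add ((v_moments.mul (opY_moments k)).const_mul b)
    ((v_moments.mul (f_moments k)).const_mul c), avg_const_mul, avg_const_mul]
  ring

lemma hasPairing_opL (hu : HasGradient V β u v) (γ : ℝ) (hf : IsTest Λ f) :
    HasPairing V β u (opL V γ f)
      (-avg V β (fun ω =>
          v 0 ω * (γ / 2 * gradGamma V 0 f ω + 1 * partialGamma (bondSupport Λ) f ω))
        + -avg V β (fun ω =>
          v 1 ω * (γ / 2 * gradGamma V 1 f ω + -1 * partialGamma (bondSupport Λ) f ω))) := by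
  rw [opL_eq_sum γ hf.dependsOn]
  exact (hu.hasPairing_sum hf (Or.inl rfl) (γ / 2) 1).add (fun i => (hu.tame i).hasAllMoments)
    (hu.hasPairing_sum hf (Or.inr rfl) (γ / 2) (-1))

end HasGradient

end Pairing

section Current

variable {V : ℝ → ℝ} {β : ℝ} {f g : Conf → ℝ} {Λ : Finset ℤ} {u : ℤ → Conf → ℝ}

/-- The centred kinetic energy `(p_0² - β⁻¹) / 2` of the site `0`. -/
def kinetic (β : ℝ) : Conf → ℝ := fun ω => ((ω 0).1 ^ 2 - β⁻¹) / 2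

/-- `ψ_e = (p_0² - β⁻¹) / 2 + (γ / 2) p_0 V'(r_e)`. The current is `W_{0,1} = Y_{0,1} ψ_1`, and
`ψ_0` is the analogous function for the field `X_0`. -/
def currentPotential (V : ℝ → ℝ) (β γ : ℝ) (e : ℤ) : Conf → ℝ := fun ω =>
  kinetic β ω + γ / 2 * ((ω 0).1 * deriv V (ω e).2)

/-- The function `(γ/2) X_0 Γ_f + Γ_f` with which the component along `X_0` of a gradient is paired
in `hasPairing_current`. -/
def siteFlux (V : ℝ → ℝ) (γ : ℝ) (Λ : Finset ℤ) (f : Conf → ℝ) : Conf → ℝ := fun ω =>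
  γ / 2 * gradGamma V 0 f ω + partialGamma (bondSupport Λ) f ω

/-- The function `(γ/2) Y_{0,1} Γ_f - Γ_f - ψ_1` with which the component along `Y_{0,1}` of a
gradient is paired in `hasPairing_current`. -/
def bondFlux (V : ℝ → ℝ) (β γ : ℝ) (Λ : Finset ℤ) (f : Conf → ℝ) : Conf → ℝ := fun ω =>
  γ / 2 * gradGamma V 1 f ω - partialGamma (bondSupport Λ) f ω - currentPotential V β γ 1 ω

lemma opY_kinetic (k e : ℤ) :
    opY V k e (kinetic β) = fun ω => if 0 = k then -((ω k).1 * deriv V (ω e).2) else 0 := by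
  refine (opY_comp_p (φ := fun x => (x ^ 2 - β⁻¹) / 2) (by fun_prop) k e 0).trans ?_
  simp [mul_comm]

variable [hV : IsConvexPotential V]

lemma opY_currentPotential (γ : ℝ) : opY V 0 1 (currentPotential V β γ 1) = current V γ := by
  have p_siteDiff : SiteDifferentiable fun ω => (ω 0).1 :=
    SiteDifferentiable.eval differentiable_fst 0
  have force_siteDiff : SiteDifferentiable fun ω => deriv V (ω 1).2 :=
    SiteDifferentiable.eval (hV.differentiable_deriv.comp differentiable_snd) 1
  have kinetic_siteDiff : SiteDifferentiable (kinetic β) :=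
    SiteDifferentiable.eval (φ := fun x => (x.1 ^ 2 - β⁻¹) / 2) (by fun_prop) 0
  refine (kinetic_siteDiff.opY_add
    ((SiteDifferentiable.const (γ / 2)).mul (p_siteDiff.mul force_siteDiff)) 0 1).trans ?_
  rw [opY_kinetic, (p_siteDiff.mul force_siteDiff).opY_const_mul, p_siteDiff.opY_mul force_siteDiff,
    opY_comp_p (φ := fun x => x) differentiable_fun_id, opY_comp_r hV.differentiable_deriv]
  funext ω
  simp only [current, if_true, deriv_id'']
  ring

variable [hβ : Fact (0 < β)]

lemma avg_p_sq_mul (hf : Tame V β f) (i : ℤ) :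
    avg V β (fun ω => (ω i).1 ^ 2 * f ω)
      = β⁻¹ * (avg V β f + avg V β fun ω => (ω i).1 * siteDeriv (1, 0) i f ω) := by
  have leibniz : siteDeriv (1, 0) i (fun ω => (ω i).1 * f ω)
      = fun ω => f ω + (ω i).1 * siteDeriv (1, 0) i f ω := by
    rw [(Tame.p (V := V) (β := β) i).siteDifferentiable.siteDeriv_mul hf.siteDifferentiable,
      siteDeriv_eval Prod.fst]
    simp [lineDeriv_comp_fst (φ := fun x => x) differentiable_fun_id]
  have by_parts := avg_p_mul ((Tame.p i).mul hf) i
  rw [leibniz, avg_add hf.hasAllMoments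
    ((Tame.p i).hasAllMoments.mul (hf.hasAllMoments_siteDeriv _ i))] at by_parts
  rw [← by_parts, inv_mul_cancel_left₀ hβ.out.ne']
  simp only [sq, mul_assoc]

lemma avg_p_sq (i : ℤ) : avg V β (fun ω => (ω i).1 ^ 2) = β⁻¹ := by
  simpa [siteDeriv_const, avg_const] using avg_p_sq_mul (Tame.const (V := V) (β := β) 1) i

lemma hasPairing_shift_p_sq_sub (hg : DependsOn g (Λ : Set ℤ)) (hg_tame : Tame V β g)
    (hg_avg : avg V β g = 0) :
    HasPairing V β (fun i => shift (-i) g) (fun ω => (ω 1).1 ^ 2 - (ω 0).1 ^ 2) 0 := by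
  let c : ℤ → ℝ := fun i => avg V β fun ω => (ω i).1 ^ 2 * g ω
  have c_finite : (Function.support c).Finite := by
    refine Λ.finite_toSet.subset fun i hi => ?_
    by_contra hiΛ
    exact hi (by simp [c, avg_p_sq_mul hg_tame, hg_avg, siteDeriv_eq_zero_of_dependsOn hg hiΛ,
      avg_const])
  have c_succ_finite : (Function.support fun i => c (i + 1)).Finite :=
    c_finite.preimage (add_left_injective (1 : ℤ)).injOn
  have telescoping : (fun i => avg V β fun ω => shift (-i) g ω * ((ω 1).1 ^ 2 - (ω 0).1 ^ 2))
      = fun i => c (i + 1) - c i := by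
    funext i
    rw [← avg_mul_shift, ← avg_sub ((Tame.p_sq _).hasAllMoments.mul hg_tame.hasAllMoments)
      ((Tame.p_sq _).hasAllMoments.mul hg_tame.hasAllMoments)]
    refine congrArg (avg V β) (funext fun ω => ?_)
    simp only [shift, zero_add, add_comm 1 i]
    ring
  refine ⟨(Tame.p_sq 1).hasAllMoments.sub (Tame.p_sq 0).hasAllMoments, ?_, ?_⟩
  · rw [telescoping]
    exact (c_succ_finite.union c_finite).subset (Function.support_sub _ _)
  · rw [telescoping, finsum_sub_distrib c_succ_finite c_finite, sub_eq_zero]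
    exact finsum_comp_equiv (Equiv.addRight (1 : ℤ))

lemma avg_p_sq_mul_energy (i j : ℤ) :
    avg V β (fun ω => (ω j).1 ^ 2 * energy V i ω)
      = β⁻¹ * avg V β (energy V i) + if i = j then β⁻¹ ^ 2 else 0 := by
  rw [avg_p_sq_mul (Tame.energy i), siteDeriv_energy, mul_add]
  congr 1
  split_ifs with hij
  · subst hij
    simp only [one_mul, zero_mul, add_zero, ← sq, avg_p_sq]
  · simp [avg_const]

lemma hasPairing_energy_p_sq_sub :
    HasPairing V β (fun i ω => (i : ℝ) * energy V i ω) (fun ω => (ω 1).1 ^ 2 - (ω 0).1 ^ 2)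
      (β⁻¹ ^ 2) := by
  have p_sq_mul_moments : ∀ i j, HasAllMoments (fun ω => (ω j).1 ^ 2 * energy V i ω) (gibbs V β) :=
    fun i j => (Tame.p_sq j).hasAllMoments.mul (Tame.energy i).hasAllMoments
  have terms :
      (fun i : ℤ => avg V β fun ω => (i : ℝ) * energy V i ω * ((ω 1).1 ^ 2 - (ω 0).1 ^ 2))
      = fun i => if i = 1 then β⁻¹ ^ 2 else 0 := by
    funext i
    calc avg V β (fun ω => (i : ℝ) * energy V i ω * ((ω 1).1 ^ 2 - (ω 0).1 ^ 2))
        = avg V β (fun ω => i * ((ω 1).1 ^ 2 * energy V i ω - (ω 0).1 ^ 2 * energy V i ω)) := by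
          congr! 2
          ring
      _ = i * ((if i = 1 then β⁻¹ ^ 2 else 0) - if i = 0 then β⁻¹ ^ 2 else 0) := by
          rw [avg_const_mul, avg_sub (p_sq_mul_moments i 1) (p_sq_mul_moments i 0),
            avg_p_sq_mul_energy, avg_p_sq_mul_energy, add_sub_add_left_eq_sub]
      _ = if i = 1 then β⁻¹ ^ 2 else 0 := by
          rcases eq_or_ne i 0 with rfl | hi
          · simp
          · split_ifs with hi₁ <;> simp [*]
  refine ⟨(Tame.p_sq 1).hasAllMoments.sub (Tame.p_sq 0).hasAllMoments, ?_, ?_⟩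
  · rw [terms]
    exact (Set.finite_singleton (1 : ℤ)).subset fun i hi => by_contra fun hi₁ => hi (if_neg hi₁)
  · rw [terms, finsum_eq_single _ 1 fun i hi => if_neg hi, if_pos rfl]

lemma Tame.kinetic : Tame V β (kinetic β) := by
  have half_centred := ((p_sq (V := V) (β := β) 0).sub (const β⁻¹)).const_mul 2⁻¹
  simpa only [inv_mul_eq_div] using! half_centred

lemma Tame.currentPotential (γ : ℝ) (e : ℤ) : Tame V β (currentPotential V β γ e) :=
  Tame.kinetic.add (((Tame.p 0).mul (Tame.force e)).const_mul (γ / 2))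

lemma hasAllMoments_siteFlux (γ : ℝ) (hf : IsTest Λ f) :
    HasAllMoments (siteFlux V γ Λ f) (gibbs V β) :=
  ((hasAllMoments_gradGamma hf.dependsOn hf.tame (Or.inl rfl)).const_mul (γ / 2)).add
    (hf.tame.partialGamma _).hasAllMoments

lemma hasAllMoments_bondFlux (γ : ℝ) (hf : IsTest Λ f) :
    HasAllMoments (bondFlux V β γ Λ f) (gibbs V β) :=
  (((hasAllMoments_gradGamma hf.dependsOn hf.tame (Or.inr rfl)).const_mul (γ / 2)).sub
    (hf.tame.partialGamma _).hasAllMoments).sub (Tame.currentPotential γ 1).hasAllMoments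

lemma HasGradient.hasPairing_current {v : ℤ → Conf → ℝ} (hu : HasGradient V β u v) {s : ℝ}
    (hs : HasPairing V β u (fun ω => (ω 1).1 ^ 2 - (ω 0).1 ^ 2) s) (γ κ : ℝ) (hf : IsTest Λ f) :
    HasPairing V β u
      (fun ω => current V γ ω + κ * ((ω 1).1 ^ 2 - (ω 0).1 ^ 2) - opL V γ f ω)
      (avg V β (fun ω => v 0 ω * siteFlux V γ Λ f ω)
        + avg V β (fun ω => v 1 ω * bondFlux V β γ Λ f ω) + κ * s) := by
  have u_moments : ∀ i, HasAllMoments (u i) (gibbs V β) := fun i => (hu.tame i).hasAllMoments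
  have current_pairing := hu.hasPairing _ (Tame.currentPotential γ 1) 0 1 (Or.inr rfl)
  rw [zero_add, opY_currentPotential, neg_zero, shift_zero] at current_pairing
  convert (current_pairing.add u_moments (hs.const_mul κ)).sub u_moments
    (hu.hasPairing_opL γ hf) using 1
  have bondFlux_split : avg V β (fun ω => v 1 ω * bondFlux V β γ Λ f ω)
      = avg V β (fun ω =>
          v 1 ω * (γ / 2 * gradGamma V 1 f ω + -1 * partialGamma (bondSupport Λ) f ω))
        - avg V β fun ω => v 1 ω * currentPotential V β γ 1 ω := by
    rw [← avg_sub ((hu.hasAllMoments 1 (Or.inr rfl)).mul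
        (((hasAllMoments_gradGamma hf.dependsOn hf.tame (Or.inr rfl)).const_mul _).add
          ((hf.tame.partialGamma _).hasAllMoments.const_mul _)))
      ((hu.hasAllMoments 1 (Or.inr rfl)).mul (Tame.currentPotential γ 1).hasAllMoments)]
    refine congrArg (avg V β) (funext fun ω => ?_)
    rw [bondFlux]
    ring
  rw [bondFlux_split]
  simp only [siteFlux, one_mul]
  ring

lemma starForm_add_starStarForm {Λ' : Finset ℤ} (hg : DependsOn g (Λ' : Set ℤ))
    (hg_tame : Tame V β g) (hg_avg : avg V β g = 0) (γ κ : ℝ) (hf : IsTest Λ f) (a : ℝ) :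
    starForm V β g
        (fun ω => current V γ ω + κ * ((ω 1).1 ^ 2 - (ω 0).1 ^ 2) - opL V γ f ω)
      + a * starStarForm V β
        (fun ω => current V γ ω + κ * ((ω 1).1 ^ 2 - (ω 0).1 ^ 2) - opL V γ f ω)
      = avg V β (fun ω => gradGamma V 0 g ω * siteFlux V γ Λ f ω)
        + avg V β (fun ω => (a * ((ω 0).1 * deriv V (ω 1).2) + gradGamma V 1 g ω)
          * bondFlux V β γ Λ f ω) + a * (κ * β⁻¹ ^ 2) := by
  have star := ((hasGradient_shift hg hg_tame).hasPairing_current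
    (hasPairing_shift_p_sq_sub hg hg_tame hg_avg) γ κ hf).finsum_eq
  have starStar := ((hasGradient_energy (V := V) (β := β)).hasPairing_current
    hasPairing_energy_p_sq_sub γ κ hf).finsum_eq
  simp only [← avg_mul_shift] at star
  simp only [mul_assoc, avg_const_mul, mul_comm (energy V _ _)] at starStar
  have bondFlux_moments := hasAllMoments_bondFlux (V := V) (β := β) γ hf
  have bond_split : avg V β (fun ω => (a * ((ω 0).1 * deriv V (ω 1).2) + gradGamma V 1 g ω)
      * bondFlux V β γ Λ f ω)
      = a * avg V β (fun ω => (ω 0).1 * deriv V (ω 1).2 * bondFlux V β γ Λ f ω)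
        + avg V β (fun ω => gradGamma V 1 g ω * bondFlux V β γ Λ f ω) := by
    rw [← avg_const_mul, ← avg_add
      ((((Tame.p 0).mul (Tame.force 1)).hasAllMoments.mul bondFlux_moments).const_mul a)
      ((hasAllMoments_gradGamma hg hg_tame (Or.inr rfl)).mul bondFlux_moments)]
    simp only [add_mul, mul_assoc]
  rw [bond_split, starForm, star, starStarForm, starStar]
  simp only [zero_mul, zero_ne_one, if_true, if_false, avg_const]
  ring

end Current

/-! ### Approximation by test functions -/

section DominatedConvergence

variable {α : Type*} {mα : MeasurableSpace α} {μ : Measure α} {a a' : ℕ → α → ℝ} {b b' : α → ℝ}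

/-- Pointwise convergence of `a n` to `b`, dominated by a function with all moments. -/
structure DominatedTendsto (μ : Measure α) (a : ℕ → α → ℝ) (b : α → ℝ) : Prop where
  aestronglyMeasurable : ∀ n, AEStronglyMeasurable (a n) μ
  bound : ∃ E, HasAllMoments E μ ∧ ∀ n x, |a n x| ≤ E x
  tendsto : ∀ x, Tendsto (fun n => a n x) atTop (𝓝 (b x))

namespace DominatedTendsto

lemma tendsto_integral (h : DominatedTendsto μ a b) :
    Tendsto (fun n => ∫ x, a n x ∂μ) atTop (𝓝 (∫ x, b x ∂μ)) := by
  obtain ⟨E, E_moments, a_le⟩ := h.bound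
  exact tendsto_integral_of_dominated_convergence E h.aestronglyMeasurable E_moments.integrable
    (fun n => .of_forall (a_le n)) (.of_forall h.tendsto)

lemma const (hb : HasAllMoments b μ) : DominatedTendsto μ (fun _ => b) b :=
  ⟨fun _ => hb.aestronglyMeasurable, ⟨_, hb.abs, fun _ _ => le_rfl⟩, fun _ => tendsto_const_nhds⟩

lemma of_tendsto [IsFiniteMeasure μ] {c : ℕ → ℝ} {l : ℝ} (hc : Tendsto c atTop (𝓝 l)) :
    DominatedTendsto μ (fun n _ => c n) fun _ => l := by
  obtain ⟨M, c_le⟩ := (Metric.isBounded_range_of_tendsto c hc).exists_norm_le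
  exact ⟨fun _ => aestronglyMeasurable_const,
    ⟨_, HasAllMoments.const M, fun n _ => c_le _ ⟨n, rfl⟩⟩, fun _ => hc⟩

lemma mul (h : DominatedTendsto μ a b) (h' : DominatedTendsto μ a' b') :
    DominatedTendsto μ (fun n x => a n x * a' n x) fun x => b x * b' x := by
  obtain ⟨E, E_moments, a_le⟩ := h.bound
  obtain ⟨E', E'_moments, a'_le⟩ := h'.bound
  refine ⟨fun n => (h.aestronglyMeasurable n).mul (h'.aestronglyMeasurable n),
    ⟨_, E_moments.mul E'_moments, fun n x => ?_⟩, fun x => (h.tendsto x).mul (h'.tendsto x)⟩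
  rw [abs_mul]
  exact mul_le_mul (a_le n x) (a'_le n x) (abs_nonneg _) ((abs_nonneg _).trans (a_le n x))

lemma add (h : DominatedTendsto μ a b) (h' : DominatedTendsto μ a' b') :
    DominatedTendsto μ (fun n x => a n x + a' n x) fun x => b x + b' x := by
  obtain ⟨E, E_moments, a_le⟩ := h.bound
  obtain ⟨E', E'_moments, a'_le⟩ := h'.bound
  exact ⟨fun n => (h.aestronglyMeasurable n).add (h'.aestronglyMeasurable n),
    ⟨_, E_moments.add E'_moments, fun n x => (abs_add_le _ _).trans
      (add_le_add (a_le n x) (a'_le n x))⟩, fun x => (h.tendsto x).add (h'.tendsto x)⟩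

lemma sub (h : DominatedTendsto μ a b) (h' : DominatedTendsto μ a' b') :
    DominatedTendsto μ (fun n x => a n x - a' n x) fun x => b x - b' x := by
  obtain ⟨E, E_moments, a_le⟩ := h.bound
  obtain ⟨E', E'_moments, a'_le⟩ := h'.bound
  exact ⟨fun n => (h.aestronglyMeasurable n).sub (h'.aestronglyMeasurable n),
    ⟨_, E_moments.add E'_moments, fun n x => (abs_sub _ _).trans
      (add_le_add (a_le n x) (a'_le n x))⟩, fun x => (h.tendsto x).sub (h'.tendsto x)⟩

lemma sum [IsFiniteMeasure μ] {ι : Type*} (s : Finset ι) {a : ι → ℕ → α → ℝ} {b : ι → α → ℝ}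
    (h : ∀ i ∈ s, DominatedTendsto μ (a i) (b i)) :
    DominatedTendsto μ (fun n x => ∑ i ∈ s, a i n x) fun x => ∑ i ∈ s, b i x := by
  classical
  induction s using Finset.induction_on with
  | empty => simpa using const (HasAllMoments.const (μ := μ) 0)
  | insert i s hi ih =>
    simp only [Finset.sum_insert hi]
    exact (h i (by simp)).add (ih fun k hk => h k (by simp [hk]))

lemma comp_measurePreserving {α' : Type*} {mα' : MeasurableSpace α'} {μ' : Measure α'}
    {T : α' → α} (h : DominatedTendsto μ a b) (hT : MeasurePreserving T μ' μ) :
    DominatedTendsto μ' (fun n x => a n (T x)) fun x => b (T x) := by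
  obtain ⟨E, E_moments, a_le⟩ := h.bound
  exact ⟨fun n => (h.aestronglyMeasurable n).comp_measurePreserving hT,
    ⟨_, E_moments.comp_measurePreserving hT, fun n x => a_le n (T x)⟩, fun x => h.tendsto (T x)⟩

end DominatedTendsto

end DominatedConvergence

section Cutoff

variable {V : ℝ → ℝ} {β : ℝ} {Λ : Finset ℤ} {H : Conf → ℝ}

/-- A smooth bump function equal to `1` near the origin of `(ℝ²)^Λ`. -/
def bump (Λ : Finset ℤ) : ContDiffBump (0 : Λ → ℝ × ℝ) := ⟨1, 2, one_pos, one_lt_two⟩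

/-- The rescaled bump function, which is `1` where all the coordinates in `Λ` are small compared
to `n`. -/
def cutoff (Λ : Finset ℤ) (n : ℕ) : Conf → ℝ := fun ω =>
  bump Λ ((1 / ((n : ℝ) + 1)) • fun k : Λ => ω k)

lemma contDiff_bump (Λ : Finset ℤ) : ContDiff ℝ ((⊤ : ℕ∞) : WithTop ℕ∞) (bump Λ) :=
  (bump Λ).contDiff

lemma tendsto_one_div_smul_restrict (Λ : Finset ℤ) (ω : Conf) :
    Tendsto (fun n : ℕ => (1 / ((n : ℝ) + 1)) • fun k : Λ => ω k) atTop (𝓝 0) := by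
  simpa using
    (tendsto_one_div_add_atTop_nhds_zero_nat (𝕜 := ℝ)).smul_const fun k : Λ => ω k

lemma isTest_cutoff (Λ : Finset ℤ) (n : ℕ) : IsTest Λ (cutoff Λ n) :=
  ⟨fun x => bump Λ ((1 / ((n : ℝ) + 1)) • x),
    (contDiff_bump Λ).comp (contDiff_const_smul (1 / ((n : ℝ) + 1))),
    (bump Λ).hasCompactSupport.comp_smul Nat.one_div_pos_of_nat.ne', fun _ => rfl⟩

lemma siteDeriv_cutoff (v : ℝ × ℝ) (i : ℤ) (n : ℕ) (ω : Conf) :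
    siteDeriv v i (cutoff Λ n) ω = 1 / ((n : ℝ) + 1) *
      fderiv ℝ (bump Λ) ((1 / ((n : ℝ) + 1)) • fun k : Λ => ω k)
        fun k => if (k : ℤ) = i then v else 0 := by
  have bump_diff : Differentiable ℝ (bump Λ) := (contDiff_bump Λ).differentiable (by simp)
  refine (siteDeriv_comp_restrict (bump_diff.comp
    (differentiable_id.const_smul (1 / ((n : ℝ) + 1)))) v i ω).trans ?_
  rw [((bump_diff _).hasFDerivAt.comp _ ((hasFDerivAt_id _).const_smul _)).fderiv]
  simp

/-- The truncation `cutoff · (H - c)` of `H`, with the constant `c` chosen so that the average is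
zero. The formula for `c` is meaningful for large `n`, when the average of the cutoff is not `0`. -/
def truncation (V : ℝ → ℝ) (β : ℝ) (Λ : Finset ℤ) (H : Conf → ℝ) (n : ℕ) : Conf → ℝ := fun ω =>
  cutoff Λ n ω * (H ω - avg V β (fun ω => cutoff Λ n ω * H ω) / avg V β (cutoff Λ n))

lemma isTest_truncation (hH : IsSmoothLocal Λ H) (n : ℕ) : IsTest Λ (truncation V β Λ H n) := by
  obtain ⟨φ, φ_smooth, H_eq⟩ := hH
  obtain ⟨θ, θ_smooth, θ_supp, cutoff_eq⟩ := isTest_cutoff Λ n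
  exact ⟨_, θ_smooth.mul (φ_smooth.sub contDiff_const), θ_supp.mul_right,
    fun ω => by rw [truncation, cutoff_eq, H_eq]⟩

lemma siteDeriv_sub_const (H : Conf → ℝ) (c : ℝ) (v : ℝ × ℝ) (i : ℤ) :
    siteDeriv v i (fun ω => H ω - c) = siteDeriv v i H := by
  funext ω
  simp [siteDeriv, lineDeriv]

lemma DominatedTendsto.tendsto_avg {a : ℕ → Conf → ℝ} {b : Conf → ℝ}
    (h : DominatedTendsto (gibbs V β) a b) :
    Tendsto (fun n => avg V β (a n)) atTop (𝓝 (avg V β b)) :=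
  h.tendsto_integral

variable [IsConvexPotential V] [Fact (0 < β)]

lemma dominatedTendsto_cutoff (Λ : Finset ℤ) :
    DominatedTendsto (gibbs V β) (cutoff Λ) fun _ => 1 := by
  refine ⟨fun n => (isTest_cutoff Λ n).hasAllMoments.aestronglyMeasurable,
    ⟨fun _ => 1, HasAllMoments.const 1, fun n ω => ?_⟩, fun ω => ?_⟩
  · rw [cutoff, abs_of_nonneg (bump Λ).nonneg]
    exact (bump Λ).le_one
  · have bump_zero : bump Λ 0 = 1 := (bump Λ).one_of_mem_closedBall (by simp [bump])
    rw [← bump_zero]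
    exact ((contDiff_bump Λ).continuous.tendsto 0).comp (tendsto_one_div_smul_restrict Λ ω)

lemma dominatedTendsto_siteDeriv_cutoff (Λ : Finset ℤ) (v : ℝ × ℝ) (i : ℤ) :
    DominatedTendsto (gibbs V β) (fun n => siteDeriv v i (cutoff Λ n)) fun _ => 0 := by
  let w : Λ → ℝ × ℝ := fun k => if (k : ℤ) = i then v else 0
  have deriv_cont : Continuous fun x => fderiv ℝ (bump Λ) x w :=
    ((contDiff_bump Λ).continuous_fderiv (by simp)).clm_apply continuous_const
  obtain ⟨C, deriv_le⟩ :=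
    ((bump Λ).hasCompactSupport.fderiv_apply (𝕜 := ℝ) w).exists_bound_of_continuous deriv_cont
  have scale_le : ∀ n : ℕ, |1 / ((n : ℝ) + 1)| ≤ 1 := fun n => by
    rw [abs_of_pos Nat.one_div_pos_of_nat, div_le_one (by positivity)]
    linarith [(n.cast_nonneg : (0 : ℝ) ≤ n)]
  refine ⟨fun n => ((isTest_cutoff Λ n).siteDeriv v i).hasAllMoments.aestronglyMeasurable,
    ⟨fun _ => 1 * C, HasAllMoments.const _, fun n ω => ?_⟩, fun ω => ?_⟩
  · rw [siteDeriv_cutoff, abs_mul]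
    exact mul_le_mul (scale_le n) (deriv_le _) (abs_nonneg _) zero_le_one
  · simp only [siteDeriv_cutoff]
    rw [← zero_mul (fderiv ℝ (bump Λ) 0 w)]
    exact tendsto_one_div_add_atTop_nhds_zero_nat.mul
      ((deriv_cont.tendsto 0).comp (tendsto_one_div_smul_restrict Λ ω))

lemma tendsto_avg_cutoff (Λ : Finset ℤ) : Tendsto (fun n => avg V β (cutoff Λ n)) atTop (𝓝 1) := by
  simpa only [avg_const] using (dominatedTendsto_cutoff (V := V) (β := β) Λ).tendsto_avg

lemma eventually_avg_truncation_eq_zero (hH : HasAllMoments H (gibbs V β)) :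
    ∀ᶠ n in atTop, avg V β (truncation V β Λ H n) = 0 := by
  filter_upwards [(tendsto_avg_cutoff (V := V) (β := β) Λ).eventually_ne one_ne_zero] with n avg_ne
  have cutoff_moments : HasAllMoments (cutoff Λ n) (gibbs V β) := (isTest_cutoff Λ n).hasAllMoments
  have truncation_eq : truncation V β Λ H n = fun ω => cutoff Λ n ω * H ω
      - avg V β (fun ω => cutoff Λ n ω * H ω) / avg V β (cutoff Λ n) * cutoff Λ n ω := by
    funext ω
    rw [truncation]
    ring
  rw [truncation_eq, avg_sub (cutoff_moments.mul hH) (cutoff_moments.const_mul _), avg_const_mul,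
    div_mul_cancel₀ _ avg_ne, sub_self]

lemma dominatedTendsto_siteDeriv_truncation (hH : Tame V β H) (hH_avg : avg V β H = 0)
    (v : ℝ × ℝ) (i : ℤ) :
    DominatedTendsto (gibbs V β) (fun n => siteDeriv v i (truncation V β Λ H n))
      (siteDeriv v i H) := by
  let c : ℕ → ℝ := fun n => avg V β (fun ω => cutoff Λ n ω * H ω) / avg V β (cutoff Λ n)
  have H_const := DominatedTendsto.const hH.hasAllMoments
  have c_tendsto : Tendsto c atTop (𝓝 0) := by
    have numerator := ((dominatedTendsto_cutoff Λ).mul H_const).tendsto_avg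
    simp only [one_mul, hH_avg] at numerator
    simpa only [zero_div] using! numerator.div (tendsto_avg_cutoff Λ) one_ne_zero
  have leibniz : ∀ n, siteDeriv v i (truncation V β Λ H n) = fun ω =>
      siteDeriv v i (cutoff Λ n) ω * (H ω - c n) + cutoff Λ n ω * siteDeriv v i H ω := by
    intro n
    refine ((isTest_cutoff Λ n).siteDifferentiable.siteDeriv_mul
      (hH.sub (Tame.const (c n))).siteDifferentiable v i).trans ?_
    rw [siteDeriv_sub_const]
  simp only [leibniz]
  simpa only [zero_mul, one_mul, zero_add] using
    ((dominatedTendsto_siteDeriv_cutoff Λ v i).mul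
      (H_const.sub (DominatedTendsto.of_tendsto c_tendsto))).add
    ((dominatedTendsto_cutoff Λ).mul (DominatedTendsto.const (hH.hasAllMoments_siteDeriv v i)))

lemma dominatedTendsto_gradGamma_truncation (hH_local : IsSmoothLocal Λ H) (hH : Tame V β H)
    (hH_avg : avg V β H = 0) {e : ℤ} (he : e = 0 ∨ e = 1) :
    DominatedTendsto (gibbs V β) (fun n => gradGamma V e (truncation V β Λ H n))
      (gradGamma V e H) := by
  rw [gradGamma_eq_sum hH_local.dependsOn he]
  simp only [gradGamma_eq_sum (isTest_truncation hH_local _).dependsOn he]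
  refine DominatedTendsto.sum _ fun k _ => ?_
  have opY_tendsto : DominatedTendsto (gibbs V β)
      (fun n => opY V k (k + e) (truncation V β Λ H n)) (opY V k (k + e) H) := by
    simp only [funext (opY_apply _ _ _)]
    exact ((DominatedTendsto.const (Tame.p k).hasAllMoments).mul
        (dominatedTendsto_siteDeriv_truncation hH hH_avg _ _)).sub
      ((DominatedTendsto.const (Tame.force (k + e)).hasAllMoments).mul
        (dominatedTendsto_siteDeriv_truncation hH hH_avg _ _))
  exact opY_tendsto.comp_measurePreserving (measurePreserving_shift (-k))

end Cutoff

/-! ### The perturbed test function `t (f + p_0² / 2)` -/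

section Perturbation

variable {V : ℝ → ℝ} {β : ℝ} {f g : Conf → ℝ} {Λ Λ' : Finset ℤ} {e : ℤ}

lemma IsSmoothLocal.mono (hf : IsSmoothLocal Λ f) (hΛ : Λ ⊆ Λ') : IsSmoothLocal Λ' f := by
  obtain ⟨φ, φ_smooth, f_eq⟩ := hf
  exact ⟨fun x => φ fun i => x ⟨i, hΛ i.2⟩,
    φ_smooth.comp (contDiff_pi.2 fun i => contDiff_apply _ _ _), f_eq⟩

lemma IsSmoothLocal.add (hf : IsSmoothLocal Λ f) (hg : IsSmoothLocal Λ g) :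
    IsSmoothLocal Λ fun ω => f ω + g ω := by
  obtain ⟨φ, φ_smooth, f_eq⟩ := hf
  obtain ⟨ψ, ψ_smooth, g_eq⟩ := hg
  exact ⟨_, φ_smooth.add ψ_smooth, fun ω => congrArg₂ (· + ·) (f_eq ω) (g_eq ω)⟩

lemma IsSmoothLocal.const_mul (hf : IsSmoothLocal Λ f) (c : ℝ) :
    IsSmoothLocal Λ fun ω => c * f ω := by
  obtain ⟨φ, φ_smooth, f_eq⟩ := hf
  exact ⟨_, contDiff_const.mul φ_smooth, fun ω => congrArg (c * ·) (f_eq ω)⟩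

lemma isSmoothLocal_kinetic (β : ℝ) : IsSmoothLocal {0} (kinetic β) :=
  ⟨fun x => ((x ⟨0, Finset.mem_singleton_self 0⟩).1 ^ 2 - β⁻¹) / 2, by fun_prop, fun _ => rfl⟩

lemma gradGamma_const_mul (hf : IsSmoothLocal Λ f) (c : ℝ) (he : e = 0 ∨ e = 1) :
    gradGamma V e (fun ω => c * f ω) = fun ω => c * gradGamma V e f ω := by
  funext ω
  rw [gradGamma_eq_sum (hf.const_mul c).dependsOn he, gradGamma_eq_sum hf.dependsOn he,
    Finset.mul_sum]
  simp only [shift, hf.siteDifferentiable.opY_const_mul]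

lemma gradGamma_add (hf : IsSmoothLocal Λ f) (hg : IsSmoothLocal Λ g) (he : e = 0 ∨ e = 1) :
    gradGamma V e (fun ω => f ω + g ω) = fun ω => gradGamma V e f ω + gradGamma V e g ω := by
  funext ω
  rw [gradGamma_eq_sum (hf.add hg).dependsOn he, gradGamma_eq_sum hf.dependsOn he,
    gradGamma_eq_sum hg.dependsOn he, ← Finset.sum_add_distrib]
  simp only [shift, hf.siteDifferentiable.opY_add hg.siteDifferentiable]

lemma gradGamma_kinetic (e : ℤ) :
    gradGamma V e (kinetic β) = fun ω => -((ω 0).1 * deriv V (ω e).2) := by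
  funext ω
  rw [gradGamma, finsum_eq_single _ 0 fun j hj => ?_]
  · simp [opY_kinetic, shift_zero]
  · simp [opY_shift, opY_kinetic, shift, hj, eq_comm]

/-- `t (f + (p_0² - β⁻¹) / 2)`, the function with which the semi-norm is tested. -/
def perturbation (β : ℝ) (f : Conf → ℝ) (t : ℝ) : Conf → ℝ := fun ω => t * (f ω + kinetic β ω)

lemma isSmoothLocal_perturbation (hf : IsSmoothLocal Λ f) (t : ℝ) :
    IsSmoothLocal (insert 0 Λ) (perturbation β f t) :=
  ((hf.mono (Finset.subset_insert 0 Λ)).add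
    ((isSmoothLocal_kinetic β).mono (by simp))).const_mul t

lemma gradGamma_perturbation (hf : IsSmoothLocal Λ f) (t : ℝ) (he : e = 0 ∨ e = 1) :
    gradGamma V e (perturbation β f t)
      = fun ω => t * (gradGamma V e f ω - (ω 0).1 * deriv V (ω e).2) := by
  have f_local := hf.mono (Finset.subset_insert 0 Λ)
  have kinetic_local : IsSmoothLocal (insert 0 Λ) (kinetic β) :=
    (isSmoothLocal_kinetic β).mono (by simp)
  unfold perturbation
  rw [gradGamma_const_mul (f_local.add kinetic_local) t he,
    gradGamma_add f_local kinetic_local he, gradGamma_kinetic]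
  simp only [← sub_eq_add_neg]

variable [IsConvexPotential V] [Fact (0 < β)]

lemma avg_kinetic : avg V β (kinetic β) = 0 := by
  have centred : avg V β (fun ω => 2⁻¹ * ((ω 0).1 ^ 2 - β⁻¹)) = 0 := by
    rw [avg_const_mul, avg_sub (Tame.p_sq 0).hasAllMoments (HasAllMoments.const _), avg_p_sq,
      avg_const, sub_self, mul_zero]
  simpa only [inv_mul_eq_div] using! centred

lemma Tame.perturbation (hf : Tame V β f) (t : ℝ) : Tame V β (perturbation β f t) :=
  (hf.add Tame.kinetic).const_mul t

lemma avg_perturbation (hf : Tame V β f) (hf_avg : avg V β f = 0) (t : ℝ) :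
    avg V β (perturbation β f t) = 0 := by
  unfold perturbation
  rw [avg_const_mul, avg_add hf.hasAllMoments Tame.kinetic.hasAllMoments, hf_avg, avg_kinetic,
    add_zero, mul_zero]

end Perturbation

section FluxFunctional

variable {V : ℝ → ℝ} {β γ κ : ℝ} {f : Conf → ℝ} {Λ : Finset ℤ}

/-- The functional maximized in the semi-norm of `W_{0,1} + κ (p_1² - p_0²) - L f`, as a function
of `a`, `v₀ = X_0 Γ_g` and `v₁ = a p_0 V'(r_1) + Y_{0,1} Γ_g`. -/
def fluxFunctional (V : ℝ → ℝ) (β γ κ : ℝ) (Λ : Finset ℤ) (f : Conf → ℝ) (a : ℝ)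
    (v₀ v₁ : Conf → ℝ) : ℝ :=
  2 * (avg V β (fun ω => v₀ ω * siteFlux V γ Λ f ω) + avg V β (fun ω => v₁ ω * bondFlux V β γ Λ f ω)
      + a * (κ * β⁻¹ ^ 2))
    - γ / 2 * avg V β (fun ω => v₁ ω ^ 2) - γ / 2 * avg V β (fun ω => v₀ ω ^ 2)

variable [IsConvexPotential V] [Fact (0 < β)]

lemma fluxFunctional_le_seminormSq (hf : IsTest Λ f) {Λ' : Finset ℤ} {g : Conf → ℝ}
    (hg : IsTest Λ' g) (hg_avg : avg V β g = 0) (a : ℝ) :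
    (fluxFunctional V β γ κ Λ f a (gradGamma V 0 g)
      (fun ω => a * ((ω 0).1 * deriv V (ω 1).2) + gradGamma V 1 g ω) : EReal)
      ≤ seminormSq V β γ
        fun ω => current V γ ω + κ * ((ω 1).1 ^ 2 - (ω 0).1 ^ 2) - opL V γ f ω := by
  rw [fluxFunctional, ← starForm_add_starStarForm hg.dependsOn hg.tame hg_avg γ κ hf, mul_add,
    ← mul_assoc]
  exact le_iSup₂_of_le g ⟨⟨Λ', hg⟩, hg_avg⟩ (le_iSup_of_le a le_rfl)

lemma tendsto_fluxFunctional (hf : IsTest Λ f) (a : ℝ) {a₀ a₁ : ℕ → Conf → ℝ} {v₀ v₁ : Conf → ℝ}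
    (h₀ : DominatedTendsto (gibbs V β) a₀ v₀) (h₁ : DominatedTendsto (gibbs V β) a₁ v₁) :
    Tendsto (fun n => fluxFunctional V β γ κ Λ f a (a₀ n) (a₁ n)) atTop
      (𝓝 (fluxFunctional V β γ κ Λ f a v₀ v₁)) := by
  have site := (h₀.mul (.const (hasAllMoments_siteFlux γ hf))).tendsto_avg
  have bond := (h₁.mul (.const (hasAllMoments_bondFlux γ hf))).tendsto_avg
  simp only [fluxFunctional, sq (v₀ _), sq (v₁ _), sq (a₀ _ _), sq (a₁ _ _)]
  exact ((((site.add bond).add_const _).const_mul 2).sub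
    ((h₁.mul h₁).tendsto_avg.const_mul _)).sub ((h₀.mul h₀).tendsto_avg.const_mul _)

lemma fluxFunctional_perturbation_le_seminormSq (hf : IsTest Λ f) (hf_avg : avg V β f = 0) (t : ℝ) :
    (fluxFunctional V β γ κ Λ f t
      (fun ω => t * (gradGamma V 0 f ω - (ω 0).1 * deriv V (ω 0).2))
      (fun ω => t * gradGamma V 1 f ω) : EReal)
      ≤ seminormSq V β γ
        fun ω => current V γ ω + κ * ((ω 1).1 ^ 2 - (ω 0).1 ^ 2) - opL V γ f ω := by
  have H_local := isSmoothLocal_perturbation (β := β) hf.isSmoothLocal t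
  have H_tame : Tame V β (perturbation β f t) := hf.tame.perturbation t
  have H_avg := avg_perturbation hf.tame hf_avg t
  have tendsto₀ := dominatedTendsto_gradGamma_truncation H_local H_tame H_avg (Or.inl rfl)
  have tendsto₁ := (DominatedTendsto.const
    (((Tame.p 0).mul (Tame.force 1)).hasAllMoments.const_mul t)).add
      (dominatedTendsto_gradGamma_truncation H_local H_tame H_avg (Or.inr rfl))
  have limit := tendsto_fluxFunctional (γ := γ) (κ := κ) hf t tendsto₀ tendsto₁
  simp only [gradGamma_perturbation hf.isSmoothLocal t (Or.inl rfl),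
    gradGamma_perturbation hf.isSmoothLocal t (Or.inr rfl), ← mul_add, add_sub_cancel] at limit
  refine le_of_tendsto ((continuous_coe_real_ereal.tendsto _).comp limit) ?_
  filter_upwards [eventually_avg_truncation_eq_zero H_tame.hasAllMoments] with n truncation_avg
  exact fluxFunctional_le_seminormSq hf (isTest_truncation H_local n) truncation_avg t

end FluxFunctional

/-! ### Completing the square -/

section Bound

variable {V : ℝ → ℝ} {β γ κ : ℝ} {f u v w : Conf → ℝ} {Λ : Finset ℤ} {e : ℤ}

lemma avg_sq_nonneg (u : Conf → ℝ) : 0 ≤ avg V β fun ω => u ω ^ 2 :=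
  integral_nonneg fun ω => sq_nonneg (u ω)

lemma avg_sub_sq_le (hu : HasAllMoments u (gibbs V β)) (hv : HasAllMoments v (gibbs V β))
    (hw : HasAllMoments w (gibbs V β)) :
    avg V β (fun ω => (u ω - w ω) ^ 2)
      ≤ 2 * avg V β (fun ω => (u ω - v ω) ^ 2) + 2 * avg V β (fun ω => (v ω - w ω) ^ 2) := by
  have uv_moments := (hu.sub hv).sq.const_mul 2
  have vw_moments := (hv.sub hw).sq.const_mul 2
  rw [← avg_const_mul, ← avg_const_mul, ← avg_add uv_moments vw_moments]
  refine integral_mono (hu.sub hw).sq.integrable (uv_moments.add vw_moments).integrable fun ω => ?_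
  linear_combination sq_nonneg (u ω - 2 * v ω + w ω)

lemma avg_sq_sub_avg_mul (hu : HasAllMoments u (gibbs V β)) (hv : HasAllMoments v (gibbs V β))
    (hγ : γ ≠ 0) :
    γ / 2 * avg V β (fun ω => u ω ^ 2) - avg V β (fun ω => u ω * v ω)
      = γ / 2 * avg V β (fun ω => (u ω - γ⁻¹ * v ω) ^ 2)
        - (2 * γ)⁻¹ * avg V β (fun ω => v ω ^ 2) := by
  simp only [← avg_const_mul]
  rw [← avg_sub (hu.sq.const_mul _) (hu.mul hv),
    ← avg_sub ((hu.sub (hv.const_mul _)).sq.const_mul _) (hv.sq.const_mul _)]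
  refine congrArg (avg V β) (funext fun ω => ?_)
  field_simp
  ring

variable [hV : IsConvexPotential V] [hβ : Fact (0 < β)]

lemma avg_kinetic_sq : avg V β (fun ω => kinetic β ω ^ 2) = β⁻¹ ^ 2 / 2 := by
  have kinetic_tame : Tame V β (kinetic β) := Tame.kinetic
  have siteDeriv_kinetic : siteDeriv (1, 0) 0 (kinetic β) = fun ω => (ω 0).1 := by
    refine (siteDeriv_eval (fun x => (x.1 ^ 2 - β⁻¹) / 2) _ _ _).trans ?_
    simp [lineDeriv_comp_fst (φ := fun x => (x ^ 2 - β⁻¹) / 2) (by fun_prop)]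
  have expand : (fun ω => kinetic β ω ^ 2)
      = fun ω => 2⁻¹ * ((ω 0).1 ^ 2 * kinetic β ω) - β⁻¹ / 2 * kinetic β ω := by
    funext ω
    simp only [kinetic]
    ring
  rw [expand, avg_sub (((Tame.p_sq 0).mul kinetic_tame).hasAllMoments.const_mul _)
    (kinetic_tame.hasAllMoments.const_mul _), avg_const_mul, avg_const_mul, avg_kinetic,
    avg_p_sq_mul kinetic_tame, avg_kinetic, siteDeriv_kinetic]
  simp only [← sq, avg_p_sq]
  ring

lemma avg_deriv_force (e : ℤ) :
    avg V β (fun ω => deriv (deriv V) (ω e).2) = avg V β fun ω => deriv (deriv V) (ω 0).2 := by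
  have shifted := avg_shift (V := V) (β := β) e fun ω => deriv (deriv V) (ω 0).2
  unfold shift at shifted
  simpa only [zero_add] using shifted

lemma avg_force_sq (e : ℤ) :
    avg V β (fun ω => deriv V (ω e).2 ^ 2)
      = β⁻¹ * avg V β fun ω => deriv (deriv V) (ω 0).2 := by
  have by_parts := avg_force_mul (Tame.force (V := V) (β := β) e) e
  rw [siteDeriv_eval fun x => deriv V x.2] at by_parts
  simp only [if_true, lineDeriv_comp_snd hV.differentiable_deriv, one_mul, ← sq,
    avg_deriv_force] at by_parts
  rw [← by_parts, inv_mul_cancel_left₀ hβ.out.ne']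

lemma avg_p_mul_force_sq (e : ℤ) :
    avg V β (fun ω => ((ω 0).1 * deriv V (ω e).2) ^ 2)
      = β⁻¹ ^ 2 * avg V β fun ω => deriv (deriv V) (ω 0).2 := by
  have force_sq_tame : Tame V β fun ω => deriv V (ω e).2 ^ 2 := by
    simpa only [sq] using (Tame.force e).mul (Tame.force e)
  have siteDeriv_zero : siteDeriv (1, 0) 0 (fun ω => deriv V (ω e).2 ^ 2) = fun _ => 0 := by
    refine (siteDeriv_eval (fun x => deriv V x.2 ^ 2) _ _ _).trans ?_
    simp [lineDeriv_comp_snd (φ := fun x => deriv V x ^ 2) (hV.differentiable_deriv.pow 2)]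
  simp only [mul_pow, avg_p_sq_mul force_sq_tame, siteDeriv_zero, mul_zero, avg_const, add_zero,
    avg_force_sq]
  ring

lemma avg_kinetic_mul_p_mul_force (e : ℤ) :
    avg V β (fun ω => kinetic β ω * ((ω 0).1 * deriv V (ω e).2)) = 0 := by
  have antisymm := avg_mul_opY (V := V) (β := β) Tame.kinetic Tame.kinetic 0 e
  simp only [opY_kinetic, if_true, mul_neg, avg_neg, mul_comm _ (kinetic β _)] at antisymm
  linarith

lemma avg_currentPotential_sq (γ : ℝ) (e : ℤ) :
    avg V β (fun ω => currentPotential V β γ e ω ^ 2)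
      = β⁻¹ ^ 2 * (1 / 2 + γ ^ 2 / 4 * avg V β fun ω => deriv (deriv V) (ω 0).2) := by
  have kinetic_moments : HasAllMoments (kinetic β) (gibbs V β) := Tame.kinetic.hasAllMoments
  have pV'_moments : HasAllMoments (fun ω : Conf => (ω 0).1 * deriv V (ω e).2) (gibbs V β) :=
    ((Tame.p 0).mul (Tame.force e)).hasAllMoments
  have expand : (fun ω => currentPotential V β γ e ω ^ 2)
      = fun ω => kinetic β ω ^ 2 + (γ * (kinetic β ω * ((ω 0).1 * deriv V (ω e).2))
        + γ ^ 2 / 4 * ((ω 0).1 * deriv V (ω e).2) ^ 2) := by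
    funext ω
    rw [currentPotential]
    ring
  rw [expand, avg_add kinetic_moments.sq
      (((kinetic_moments.mul pV'_moments).const_mul _).add (pV'_moments.sq.const_mul _)),
    avg_add ((kinetic_moments.mul pV'_moments).const_mul _) (pV'_moments.sq.const_mul _),
    avg_const_mul, avg_const_mul, avg_kinetic_sq, avg_kinetic_mul_p_mul_force, avg_p_mul_force_sq]
  ring

lemma avg_gradGamma_mul_partialGamma (hf : IsTest Λ f) (he : e = 0 ∨ e = 1) :
    avg V β (fun ω => gradGamma V e f ω * partialGamma (bondSupport Λ) f ω) = 0 := by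
  have Γ_tame : Tame V β (partialGamma (bondSupport Λ) f) := hf.tame.partialGamma _
  have antisymm := avg_mul_opY Γ_tame Γ_tame 0 e
  rw [gradGamma_eq_opY hf.dependsOn hf.siteDifferentiable he]
  simp only [mul_comm (partialGamma (bondSupport Λ) f _)] at antisymm
  linarith

lemma avg_p_mul_force_mul_partialGamma (hf : IsTest Λ f) (he : e = 0 ∨ e = 1) :
    avg V β (fun ω => (ω 0).1 * deriv V (ω e).2 * partialGamma (bondSupport Λ) f ω)
      = avg V β (fun ω => gradGamma V e f ω * kinetic β ω) := by
  have antisymm := avg_mul_opY Tame.kinetic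
    (hf.tame.partialGamma (V := V) (β := β) (bondSupport Λ)) 0 e
  rw [← gradGamma_eq_opY hf.dependsOn hf.siteDifferentiable he, opY_kinetic] at antisymm
  simp only [if_true, neg_mul, mul_comm (kinetic β _)] at antisymm
  rw [antisymm, avg_neg, neg_neg]

lemma avg_mul_siteFlux (γ : ℝ) (hf : IsTest Λ f) :
    avg V β (fun ω => (gradGamma V 0 f ω - (ω 0).1 * deriv V (ω 0).2) * siteFlux V γ Λ f ω)
      = γ / 2 * avg V β (fun ω => gradGamma V 0 f ω ^ 2)
        - avg V β (fun ω => gradGamma V 0 f ω * currentPotential V β γ 0 ω) := by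
  have X_moments : HasAllMoments (gradGamma V 0 f) (gibbs V β) :=
    hasAllMoments_gradGamma hf.dependsOn hf.tame (Or.inl rfl)
  have Γ_moments : HasAllMoments (partialGamma (bondSupport Λ) f) (gibbs V β) :=
    (hf.tame.partialGamma _).hasAllMoments
  have kinetic_moments : HasAllMoments (kinetic β) (gibbs V β) := Tame.kinetic.hasAllMoments
  have ψ_moments : HasAllMoments (currentPotential V β γ 0) (gibbs V β) :=
    (Tame.currentPotential γ 0).hasAllMoments
  have pV'_moments : HasAllMoments (fun ω : Conf => (ω 0).1 * deriv V (ω 0).2) (gibbs V β) :=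
    ((Tame.p 0).mul (Tame.force 0)).hasAllMoments
  have expand : (fun ω =>
        (gradGamma V 0 f ω - (ω 0).1 * deriv V (ω 0).2) * siteFlux V γ Λ f ω)
      = fun ω => γ / 2 * gradGamma V 0 f ω ^ 2
          - gradGamma V 0 f ω * currentPotential V β γ 0 ω
        + (gradGamma V 0 f ω * partialGamma (bondSupport Λ) f ω
          + (gradGamma V 0 f ω * kinetic β ω
            - (ω 0).1 * deriv V (ω 0).2 * partialGamma (bondSupport Λ) f ω)) := by
    funext ω
    simp only [siteFlux, currentPotential]
    ring
  rw [expand, avg_add ((X_moments.sq.const_mul _).sub (X_moments.mul ψ_moments))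
      ((X_moments.mul Γ_moments).add
        ((X_moments.mul kinetic_moments).sub (pV'_moments.mul Γ_moments))),
    avg_sub (X_moments.sq.const_mul _) (X_moments.mul ψ_moments), avg_const_mul,
    avg_add (X_moments.mul Γ_moments)
      ((X_moments.mul kinetic_moments).sub (pV'_moments.mul Γ_moments)),
    avg_sub (X_moments.mul kinetic_moments) (pV'_moments.mul Γ_moments),
    avg_gradGamma_mul_partialGamma hf (Or.inl rfl),
    avg_p_mul_force_mul_partialGamma hf (Or.inl rfl), sub_self, add_zero, add_zero]

lemma avg_mul_bondFlux (γ : ℝ) (hf : IsTest Λ f) :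
    avg V β (fun ω => gradGamma V 1 f ω * bondFlux V β γ Λ f ω)
      = γ / 2 * avg V β (fun ω => gradGamma V 1 f ω ^ 2)
        - avg V β (fun ω => gradGamma V 1 f ω * currentPotential V β γ 1 ω) := by
  have Y_moments : HasAllMoments (gradGamma V 1 f) (gibbs V β) :=
    hasAllMoments_gradGamma hf.dependsOn hf.tame (Or.inr rfl)
  have Γ_moments : HasAllMoments (partialGamma (bondSupport Λ) f) (gibbs V β) :=
    (hf.tame.partialGamma _).hasAllMoments
  have ψ_moments : HasAllMoments (currentPotential V β γ 1) (gibbs V β) :=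
    (Tame.currentPotential γ 1).hasAllMoments
  have expand : (fun ω => gradGamma V 1 f ω * bondFlux V β γ Λ f ω)
      = fun ω => γ / 2 * gradGamma V 1 f ω ^ 2
          - gradGamma V 1 f ω * currentPotential V β γ 1 ω
        - gradGamma V 1 f ω * partialGamma (bondSupport Λ) f ω := by
    funext ω
    simp only [bondFlux]
    ring
  rw [expand, avg_sub ((Y_moments.sq.const_mul _).sub (Y_moments.mul ψ_moments))
      (Y_moments.mul Γ_moments),
    avg_sub (Y_moments.sq.const_mul _) (Y_moments.mul ψ_moments), avg_const_mul,
    avg_gradGamma_mul_partialGamma hf (Or.inr rfl), sub_zero]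

end Bound

section DiffusionConstant

variable {V : ℝ → ℝ} {β γ κ t : ℝ} {f : Conf → ℝ} {Λ : Finset ℤ}

/-- `(γ/2) ⟨(X_0 Γ_f - γ⁻¹ ψ_0)² + (Y_{0,1} Γ_f - γ⁻¹ ψ_1)²⟩`, the squares completed in
`fluxFunctional`. -/
def squareDefect (V : ℝ → ℝ) (β γ : ℝ) (f : Conf → ℝ) : ℝ :=
  γ / 2 * (avg V β (fun ω => (gradGamma V 0 f ω - γ⁻¹ * currentPotential V β γ 0 ω) ^ 2)
    + avg V β (fun ω => (gradGamma V 1 f ω - γ⁻¹ * currentPotential V β γ 1 ω) ^ 2))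

/-- The Dirichlet form `(γ/2) ⟨(X_0 Γ_f - p_0 V'(r_0))² + (Y_{0,1} Γ_f)²⟩` of the perturbation
`f + p_0² / 2`, tilted by `p_0 V'(r_1)`. -/
def perturbationEnergy (V : ℝ → ℝ) (β γ : ℝ) (f : Conf → ℝ) : ℝ :=
  γ / 2 * (avg V β (fun ω => (gradGamma V 0 f ω - (ω 0).1 * deriv V (ω 0).2) ^ 2)
    + avg V β (fun ω => gradGamma V 1 f ω ^ 2))

/-- `β⁻²` times the amount by which `κ` exceeds `(γ/4) ⟨V''(r_0)⟩ + 1/(2γ)`. -/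
def excess (V : ℝ → ℝ) (β γ κ : ℝ) : ℝ :=
  β⁻¹ ^ 2 * (κ - (γ / 4 * avg V β (fun ω => deriv (deriv V) (ω 0).2) + 1 / (2 * γ)))

lemma squareDefect_nonneg (hγ : 0 ≤ γ) : 0 ≤ squareDefect V β γ f :=
  mul_nonneg (by positivity) (add_nonneg (avg_sq_nonneg _) (avg_sq_nonneg _))

variable [IsConvexPotential V] [Fact (0 < β)]

lemma fluxFunctional_perturbation (hγ : γ ≠ 0) (hf : IsTest Λ f) (t : ℝ) :
    fluxFunctional V β γ κ Λ f t
        (fun ω => t * (gradGamma V 0 f ω - (ω 0).1 * deriv V (ω 0).2))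
        (fun ω => t * gradGamma V 1 f ω)
      = 2 * t * (excess V β γ κ + squareDefect V β γ f) - t ^ 2 * perturbationEnergy V β γ f := by
  have square : ∀ e, e = 0 ∨ e = 1 →
      γ / 2 * avg V β (fun ω => gradGamma V e f ω ^ 2)
        - avg V β (fun ω => gradGamma V e f ω * currentPotential V β γ e ω)
      = γ / 2 * avg V β (fun ω => (gradGamma V e f ω - γ⁻¹ * currentPotential V β γ e ω) ^ 2)
        - (2 * γ)⁻¹
          * (β⁻¹ ^ 2 * (1 / 2 + γ ^ 2 / 4 * avg V β fun ω => deriv (deriv V) (ω 0).2)) := by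
    intro e he
    rw [avg_sq_sub_avg_mul (hasAllMoments_gradGamma hf.dependsOn hf.tame he)
      (Tame.currentPotential γ e).hasAllMoments hγ, avg_currentPotential_sq]
  simp only [fluxFunctional, mul_assoc t, mul_pow t, avg_const_mul, avg_mul_siteFlux γ hf,
    avg_mul_bondFlux γ hf, square 0 (Or.inl rfl), square 1 (Or.inr rfl), excess, squareDefect,
    perturbationEnergy]
  field_simp
  ring

lemma exists_perturbationEnergy_le (V : ℝ → ℝ) [IsConvexPotential V] (β : ℝ) [Fact (0 < β)]
    (hγ : 0 ≤ γ) :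
    ∃ C, ∀ (Λ : Finset ℤ) (f : Conf → ℝ), IsTest Λ f →
      perturbationEnergy V β γ f ≤ 2 * squareDefect V β γ f + C := by
  have ψ_moments : ∀ e, HasAllMoments (fun ω => γ⁻¹ * currentPotential V β γ e ω) (gibbs V β) :=
    fun e => (Tame.currentPotential γ e).hasAllMoments.const_mul _
  refine ⟨γ * (avg V β (fun ω =>
      (γ⁻¹ * currentPotential V β γ 0 ω - (ω 0).1 * deriv V (ω 0).2) ^ 2)
    + avg V β (fun ω => (γ⁻¹ * currentPotential V β γ 1 ω) ^ 2)), fun Λ f hf => ?_⟩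
  have site := avg_sub_sq_le (hasAllMoments_gradGamma hf.dependsOn hf.tame (Or.inl rfl))
    (ψ_moments 0) ((Tame.p 0).mul (Tame.force 0)).hasAllMoments
  have bond := avg_sub_sq_le (hasAllMoments_gradGamma hf.dependsOn hf.tame (Or.inr rfl))
    (ψ_moments 1) (HasAllMoments.const 0)
  simp only [sub_zero, perturbationEnergy, squareDefect] at bond ⊢
  linear_combination γ / 2 * (site + bond)

lemma IsDiffusionConstant.exists_two_mul_excess_le (hκ : IsDiffusionConstant V β γ κ)
    (hγ : 0 < γ) : ∃ C, ∀ t, 0 < t → t ≤ 1 → 2 * excess V β γ κ ≤ t * (1 + C) := by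
  obtain ⟨C, energy_le⟩ := exists_perturbationEnergy_le V β hγ.le
  refine ⟨C, fun t t_pos t_le_one => ?_⟩
  obtain ⟨f, ⟨⟨Λ, hf⟩, hf_avg⟩, seminorm_lt⟩ := hκ (t ^ 2) (by positivity)
  have tested := (fluxFunctional_perturbation_le_seminormSq hf hf_avg t).trans_lt seminorm_lt
  rw [fluxFunctional_perturbation hγ.ne' hf, EReal.coe_lt_coe_iff] at tested
  have defect_nonneg : 0 ≤ (1 - t) * squareDefect V β γ f :=
    mul_nonneg (sub_nonneg.2 t_le_one) (squareDefect_nonneg hγ.le)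
  refine le_of_mul_le_mul_left ?_ t_pos
  linear_combination tested + t ^ 2 * energy_le Λ f hf + 2 * t * defect_nonneg

lemma IsDiffusionConstant.excess_nonpos (hκ : IsDiffusionConstant V β γ κ) (hγ : 0 < γ) :
    excess V β γ κ ≤ 0 := by
  obtain ⟨C, excess_le⟩ := hκ.exists_two_mul_excess_le hγ
  have limit : Tendsto (fun t : ℝ => t * (1 + C)) (𝓝[>] 0) (𝓝 0) := by
    refine tendsto_nhdsWithin_of_tendsto_nhds ?_
    simpa using (tendsto_id (α := ℝ) (x := 𝓝 0)).mul_const (1 + C)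
  have two_mul_le : 2 * excess V β γ κ ≤ 0 := by
    refine ge_of_tendsto limit ?_
    filter_upwards [Ioc_mem_nhdsGT zero_lt_one] with t ht
    exact excess_le t ht.1 ht.2
  linarith

end DiffusionConstant

end

end AnharmonicChain

theorem mainTheorem3_general {V : ℝ → ℝ} {δm δp β γ κ : ℝ} (hV : ContDiff ℝ 2 V) (hδm : 0 < δm)
    (hV_lower : ∀ r, δm ≤ deriv (deriv V) r) (hV_upper : ∀ r, deriv (deriv V) r ≤ δp)
    (hβ : 0 < β) (hγ : 0 < γ) (hκ : AnharmonicChain.IsDiffusionConstant V β γ κ) :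
    κ ≤ γ / 4 * AnharmonicChain.avg V β (fun ω => deriv (deriv V) (ω 0).2) + 1 / (2 * γ) := by
  have : AnharmonicChain.IsConvexPotential V :=
    ⟨hV, δm, δp, hδm, fun r => ⟨hV_lower r, hV_upper r⟩⟩
  have : Fact (0 < β) := ⟨hβ⟩
  exact sub_nonpos.1 (nonpos_of_mul_nonpos_right (hκ.excess_nonpos hγ) (by positivity))

theorem mainTheorem3 (V : ℝ → ℝ) (hV_nonneg : ∀ r, 0 ≤ V r)
    (hV_smooth : ContDiff ℝ ((⊤ : ℕ∞) : WithTop ℕ∞) V)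
    (hV_symm : ∀ r, V (-r) = V r) (δm δp : ℝ) (hδm : 0 < δm)
    (hV_lower : ∀ r, δm ≤ deriv (deriv V) r) (hV_upper : ∀ r, deriv (deriv V) r ≤ δp)
    (hδ : ((3 : ℝ) / 4) ^ ((1 : ℝ) / 16) < δm / δp)
    (β γ : ℝ) (hβ : 0 < β) (hγ : 0 < γ)
    (κ : ℝ) (hκ : AnharmonicChain.IsDiffusionConstant V β γ κ) :
    κ ≤ γ / 4 * AnharmonicChain.avg V β (fun ω => deriv (deriv V) (ω 0).2) + 3 / (4 * γ) := by
  refine (mainTheorem3_general (hV_smooth.of_le (WithTop.coe_le_coe.2 le_top)) hδm hV_lower hV_upper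
    hβ hγ hκ).trans (add_le_add_right ?_ _)
  rw [div_le_div_iff₀ (by positivity) (by positivity)]
  linarith
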